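/- Theorem (Iterated matrix Rosenthal). For every integer $q\ge 1$ there are constants $C_q, K_q, K_q'$ depending only on $q$ such that the following holds. Let $m,d_1,d_2$ be nonnegative integers, $d=\max(d_1,d_2)$, let $A_{i_1,\dots,i_q}$ ($i_1,\dots,i_q\in[m]$) be deterministic real $d_1\times d_2$ matrices, and let $h$ be a real random variable with zero mean and unit variance. Let $h^{(t)}_i$ ($t\in[q]$, $i\in[m]$) be independent copies of $h$, and consider the decoupled matrix chaos $$Y=\sum_{i_1,\dots,i_q\in[m]} h^{(1)}_{i_1}\cdots h^{(q)}_{i_q}\,A_{i_1,\dots,i_q}.$$ Write $\mathcal A_{i_1,\dots,i_{q+2}}=(A_{i_1,\dots,i_q})_{i_{q+1},i_{q+2}}$, where $i_1,\dots,i_q\in[m]$, $i_{q+1}\in[d_1]$, $i_{q+2}\in[d_2]$. For $R,C\subseteq[q+2]$ define the flattening $$\mathcal A_{[R|C]}=\sum_{i_1,\dots,i_{q+2}}\Big(\bigotimes_{t\in R}e_{i_t}\Big)\otimes\Big(\bigotimes_{t\in C}e_{i_t}^\top\Big)\,\mathcal A_{i_1,\dots,i_{q+2}},$$ where $e_i$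 are the standard basis vectors, and let, with $\|\cdot\|$ the spectral norm, $$\sigma(\mathcal A)=\max_{\substack{R=[q+2]\setminus C\\ q+1\in R,\ q+2\in C}}\|\mathcal A_{[R|C]}\|,\qquad r(\mathcal A)=\max_{\substack{R\cup C=[q+2]\\ q+1\in R,\ q+2\in C\\ \emptyset\ne R\cap C\subseteq[q]}}\|\mathcal A_{[R|C]}\|.$$ Put $\alpha(h)=\|h\|_{L^{p}}=(\mathbb E|h|^p)^{1/p}\in[0,\infty]$ with $p=\log(d+m)$ (with $\alpha(h)=0$ if $p=0$, and $0\cdot\infty=0$). Then $$\mathbb E\|Y\|\le K_q'\Big(\log(d+m)^{q/2}\,\sigma(\mathcal A)+\alpha(h)^q\log(d+m)^{(q+1)/2}\,r(\mathcal A)\Big),$$ and, whenever $d+m\ge 8$ (that is, $\log(d+m)\ge 2$), $$\sigma(\mathcal A)-C_q\,\alpha(h)^q\log(d+m)^{q/2}\,r(\mathcal A)\le K_q\,\mathbb E\|Y\| .$$ -/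

import Mathlib

open MeasureTheory ProbabilityTheory
open scoped NNReal ENNReal Matrix.Norms.L2Operator

namespace MatrixChaos

/-- The `q + 2` coordinates of the coefficient tensor: `Sum.inl t` are the `q` chaos coordinates,
`Sum.inr 0` and `Sum.inr 1` are the two matrix coordinates `q + 1` and `q + 2`. -/
abbrev Coord (q : ℕ) : Type := Fin q ⊕ Fin 2

/-- The number of values taken by each coordinate: `m` for a chaos coordinate, `d₁` and `d₂` for the
row and column coordinates of the matrix coefficients. -/
def coordDim {q : ℕ} (m d₁ d₂ : ℕ) : Coord q → ℕ
  | Sum.inl _ => m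
  | Sum.inr 0 => d₁
  | Sum.inr 1 => d₂

/-- Multi-indices `(i_t : t ∈ S)` for a set `S` of coordinates. -/
abbrev MultiIndex {q : ℕ} (m d₁ d₂ : ℕ) (S : Finset (Coord q)) : Type :=
  (t : S) → Fin (coordDim m d₁ d₂ t.1)

/-- The coefficient tensor `𝒜_{i_1,…,i_{q+2}} = (A_{i_1,…,i_q})_{i_{q+1},i_{q+2}}`. -/
def tensor {q m d₁ d₂ : ℕ} (A : (Fin q → Fin m) → Matrix (Fin d₁) (Fin d₂) ℝ)
    (i : (t : Coord q) → Fin (coordDim m d₁ d₂ t)) : ℝ :=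
  A (fun t => i (Sum.inl t)) (i (Sum.inr 0)) (i (Sum.inr 1))

/-- The flattening
`∑_i (⨂_{t ∈ R} e_{i_t}) ⊗ (⨂_{t ∈ C} e_{i_t}ᵀ) 𝒜_i`, for arbitrary sets of coordinates `R`, `C`.
The entry of `⨂_{t ∈ R} e_{i_t}` at `ρ` is `1` if `i_t = ρ_t` for all `t ∈ R`, and `0` otherwise. -/
def flattening {q m d₁ d₂ : ℕ} (A : (Fin q → Fin m) → Matrix (Fin d₁) (Fin d₂) ℝ)
    (R C : Finset (Coord q)) :
    Matrix (MultiIndex m d₁ d₂ R) (MultiIndex m d₁ d₂ C) ℝ :=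
  Matrix.of fun ρ γ =>
    ∑ i : (t : Coord q) → Fin (coordDim m d₁ d₂ t),
      (if ∀ t : R, i t.1 = ρ t then 1 else 0) * (if ∀ t : C, i t.1 = γ t then 1 else 0) *
        tensor A i

/-- `σ(𝒜)`: the largest spectral norm of a `σ`-flattening. -/
noncomputable def sigmaParam {q m d₁ d₂ : ℕ}
    (A : (Fin q → Fin m) → Matrix (Fin d₁) (Fin d₂) ℝ) : ℝ≥0 :=
  (Finset.univ.filter fun RC : Finset (Coord q) × Finset (Coord q) =>
      RC.1 = RC.2ᶜ ∧ Sum.inr 0 ∈ RC.1 ∧ Sum.inr 1 ∈ RC.2).sup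
    fun RC => ‖flattening A RC.1 RC.2‖₊

/-- `r(𝒜)`: the largest spectral norm of an `r`-flattening, that is, of a flattening with
`R ∪ C = [q+2]`, `q+1 ∈ R`, `q+2 ∈ C` and `∅ ≠ R ∩ C ⊆ [q]`. -/
noncomputable def rParam {q m d₁ d₂ : ℕ}
    (A : (Fin q → Fin m) → Matrix (Fin d₁) (Fin d₂) ℝ) : ℝ≥0 :=
  (Finset.univ.filter fun RC : Finset (Coord q) × Finset (Coord q) =>
      RC.1 ∪ RC.2 = Finset.univ ∧ Sum.inr 0 ∈ RC.1 ∧ Sum.inr 1 ∈ RC.2 ∧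
        (RC.1 ∩ RC.2).Nonempty ∧ ∀ x ∈ RC.1 ∩ RC.2, ∃ t : Fin q, x = Sum.inl t).sup
    fun RC => ‖flattening A RC.1 RC.2‖₊

/-- The decoupled matrix chaos
`∑_{i_1,…,i_q} h^{(1)}_{i_1} ⋯ h^{(q)}_{i_q} A_{i_1,…,i_q}`, where `H t i = h^{(t)}_i`. -/
def decoupledChaos {Ω : Type*} {q m d₁ d₂ : ℕ}
    (A : (Fin q → Fin m) → Matrix (Fin d₁) (Fin d₂) ℝ) (H : Fin q → Fin m → Ω → ℝ) (ω : Ω) :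
    Matrix (Fin d₁) (Fin d₂) ℝ :=
  ∑ i : Fin q → Fin m, (∏ t : Fin q, H t (i t) ω) • A i

/-- `log (d + m)` with `d = max d₁ d₂`. -/
noncomputable def logDim (m d₁ d₂ : ℕ) : ℝ := Real.log ((max d₁ d₂ + m : ℕ) : ℝ)

/-- `α(h) = ‖h‖_{L^{log (d + m)}}`, an element of `[0, ∞]`. -/
noncomputable def alphaParam {Ω₀ : Type*} [MeasurableSpace Ω₀] (μ : Measure Ω₀) (h : Ω₀ → ℝ)
    (m d₁ d₂ : ℕ) : ℝ≥0∞ :=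
  eLpNorm h (ENNReal.ofReal (logDim m d₁ d₂)) μ

end MatrixChaos

set_option linter.unusedSectionVars false

namespace MatrixChaos

/-! ### Spectral norm through quadratic forms -/

section OperatorNorm

variable {I J : Type*} [Fintype I] [Fintype J] [DecidableEq J]

/-! The chaos is linear in each block of coefficients, so conditionally on the other blocks it is a
matrix series `∑ x_i A_i` with centered independent `x_i`. Symmetrization and the noncommutative
Khintchine inequality (`signAvg_opNorm_le`) bound its mean norm by `√log` times the mean norms of
the row stack and the column stack of the `x_i A_i`. Stacking moves the chaos coordinate into the
rows or the columns of the flattening. Once every coordinate has been moved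
(`exists_partition_meanNorm_le`), only flattenings of `σ` type remain, at cost `log^(q/2)`, but
their entries still carry the random weights.

The weights are then removed one block at a time. For a row stack, the squared norm is the norm of
the Gram sum `∑ x_i² A_iᵀ A_i`, and since `x_i² - 1` is centered, a second use of Khintchine
controls its distance to `∑ A_iᵀ A_i`. The resulting bound involves the weighted stack itself;
solving it gives `lintegral_enorm_rowStack_deviation`: replacing the weights by `1` costs at most a
constant times `√log · max ‖A_i‖ · S`, where `S` bounds the `L²` norm of `max |x_i|`. The slices
`A_i` are diagonal blocks of the flattening whose rows and columns both contain the coordinate, so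
this error is governed by `r` (`meanNorm_deviation`).

The deviation estimate is two-sided. For the lower bound it compares a `σ`-flattening with its
weighted mean. That mean is at most a constant times `E‖Y‖`, because a row or column stack is
dominated by the random sum (`norm_rowStack_le_signAvg`, from Khintchine in Hilbert space), with no
loss in dimension.

Finally `S ≤ 3 α(h)`, because the maximum of `m` copies has `L^l` norm at most `m^(1/l) ‖h‖_l ≤ e
‖h‖_l` for `l = log (d + m) ≥ 2`; dimensions below `8` are treated separately. -/

theorem mulVec_dotProduct_le (A : Matrix I J ℝ) (v : J → ℝ) :
    (A.mulVec v) ⬝ᵥ (A.mulVec v) ≤ ‖A‖ ^ 2 * (v ⬝ᵥ v) := by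
  have h := A.l2_opNorm_mulVec (WithLp.toLp 2 v)
  have h2 := pow_le_pow_left₀ (norm_nonneg _) h 2
  rw [mul_pow, EuclideanSpace.norm_sq_eq, EuclideanSpace.norm_sq_eq] at h2
  simpa [dotProduct, ← pow_two] using h2

theorem opNorm_le_of_mulVec (A : Matrix I J ℝ) {c : ℝ} (hc : 0 ≤ c)
    (h : ∀ v : J → ℝ, (A.mulVec v) ⬝ᵥ (A.mulVec v) ≤ c ^ 2 * (v ⬝ᵥ v)) : ‖A‖ ≤ c := by
  rw [Matrix.l2_opNorm_def]
  refine ContinuousLinearMap.opNorm_le_bound _ hc fun x => ?_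
  refine le_of_sq_le_sq ?_ (by positivity)
  rw [mul_pow, EuclideanSpace.norm_sq_eq, EuclideanSpace.norm_sq_eq]
  simpa [dotProduct, ← pow_two] using h x

theorem opNorm_transpose [DecidableEq I] (A : Matrix I J ℝ) : ‖A.transpose‖ = ‖A‖ := by
  simpa [Matrix.conjTranspose_eq_transpose_of_trivial] using A.l2_opNorm_conjTranspose

theorem opNorm_transpose_mul_self (A : Matrix I J ℝ) : ‖A.transpose * A‖ = ‖A‖ ^ 2 := by
  simpa [Matrix.conjTranspose_eq_transpose_of_trivial, pow_two] using
    A.l2_opNorm_conjTranspose_mul_self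

end OperatorNorm

/-! ### Trace inequalities for symmetric matrices -/

section Khintchine

variable {n : Type*} [Fintype n] [DecidableEq n]

theorem exists_diagonalization (X : Matrix n n ℝ) (hX : X.transpose = X) :
    ∃ (U : Matrix n n ℝ) (l : n → ℝ), U * U.transpose = 1 ∧
      ∀ j : ℕ, X ^ j = U * Matrix.diagonal (fun a => l a ^ j) * U.transpose := by
  have hH : X.IsHermitian := by
    rw [Matrix.IsHermitian, Matrix.conjTranspose_eq_transpose_of_trivial, hX]
  set U : Matrix n n ℝ := (hH.eigenvectorUnitary : Matrix n n ℝ) with hU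
  have hs : star U = U.transpose := by
    rw [Matrix.star_eq_conjTranspose, Matrix.conjTranspose_eq_transpose_of_trivial]
  have h1 : U * U.transpose = 1 := by
    rw [← hs]; exact Unitary.mul_star_self_of_mem hH.eigenvectorUnitary.2
  have h2 : U.transpose * U = 1 := by
    rw [← hs]; exact Unitary.star_mul_self_of_mem hH.eigenvectorUnitary.2
  have h3 : X = U * Matrix.diagonal hH.eigenvalues * U.transpose := by
    have := hH.spectral_theorem
    rw [Unitary.conjStarAlgAut_apply] at this
    rw [← hs]
    exact this
  generalize hH.eigenvalues = l at h3
  refine ⟨U, l, h1, fun j => ?_⟩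
  induction j with
  | zero => simp [h1]
  | succ j ih =>
    rw [pow_succ, ih]
    conv_lhs => rw [h3]
    calc _ = U * Matrix.diagonal (fun a => l a ^ j) * (U.transpose * U) *
          Matrix.diagonal l * U.transpose := by simp only [Matrix.mul_assoc]
      _ = _ := by
        rw [h2, Matrix.mul_one, Matrix.mul_assoc U, Matrix.diagonal_mul_diagonal]
        simp only [pow_succ]

/-- The weights on the right are squares, hence nonnegative, so a scalar inequality between
eigenvalues becomes a trace inequality even though the matrices do not commute. -/
theorem trace_diagonalization (H U V : Matrix n n ℝ) (hH : H.transpose = H) (a b : n → ℝ) :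
    (H * (U * Matrix.diagonal a * U.transpose) * H *
      (V * Matrix.diagonal b * V.transpose)).trace =
      ∑ i, ∑ k, (V.transpose * H * U) i k ^ 2 * (a k * b i) := by
  set W := V.transpose * H * U with hW
  have hWt : W.transpose = U.transpose * H * V := by
    rw [hW]; simp [Matrix.transpose_mul, hH, Matrix.mul_assoc]
  have : (H * (U * Matrix.diagonal a * U.transpose) * H *
      (V * Matrix.diagonal b * V.transpose)).trace =
      (W * Matrix.diagonal a * (W.transpose * Matrix.diagonal b)).trace := by
    rw [hWt, hW, show H * (U * Matrix.diagonal a * U.transpose) * H *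
      (V * Matrix.diagonal b * V.transpose) = (H * (U * Matrix.diagonal a * U.transpose) * H *
      (V * Matrix.diagonal b)) * V.transpose by simp only [Matrix.mul_assoc],
      Matrix.trace_mul_comm]
    simp only [Matrix.mul_assoc]
  rw [this, Matrix.trace]
  refine Finset.sum_congr rfl fun i _ => ?_
  rw [Matrix.diag_apply, Matrix.mul_apply]
  refine Finset.sum_congr rfl fun k _ => ?_
  rw [Matrix.mul_diagonal, Matrix.mul_diagonal, Matrix.transpose_apply]
  ring

theorem abs_pow_mul_pow_le (x y : ℝ) (j k p : ℕ) (h : j + k = 2 * p) :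
    x ^ j * y ^ k ≤ x ^ (2 * p) + y ^ (2 * p) := by
  have hx : x ^ (2 * p) = |x| ^ (2 * p) := by rw [pow_mul, pow_mul, sq_abs]
  have hy : y ^ (2 * p) = |y| ^ (2 * p) := by rw [pow_mul, pow_mul, sq_abs]
  have h0 : x ^ j * y ^ k ≤ |x| ^ j * |y| ^ k := by
    rw [← abs_pow, ← abs_pow, ← abs_mul]; exact le_abs_self _
  rw [hx, hy]
  refine h0.trans ?_
  rcases le_total |x| |y| with hxy | hxy
  · calc |x| ^ j * |y| ^ k ≤ |y| ^ j * |y| ^ k := by gcongr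
      _ = |y| ^ (2 * p) := by rw [← pow_add, h]
      _ ≤ _ := by have : 0 ≤ |x| ^ (2 * p) := by positivity
                  linarith
  · calc |x| ^ j * |y| ^ k ≤ |x| ^ j * |x| ^ k := by gcongr
      _ = |x| ^ (2 * p) := by rw [← pow_add, h]
      _ ≤ _ := by have : 0 ≤ |y| ^ (2 * p) := by positivity
                  linarith

theorem trace_mul_pow_mul_pow_le (H X Y : Matrix n n ℝ) (hH : H.transpose = H)
    (hX : X.transpose = X) (hY : Y.transpose = Y) (j k p : ℕ) (h : j + k = 2 * p) :
    (H * X ^ j * H * Y ^ k).trace ≤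
      (H * H * X ^ (2 * p)).trace + (H * H * Y ^ (2 * p)).trace := by
  obtain ⟨U, l, hU, hUp⟩ := exists_diagonalization X hX
  obtain ⟨V, m, hV, hVp⟩ := exists_diagonalization Y hY
  have e1 : (H * H * X ^ (2 * p)).trace = (H * X ^ (2 * p) * H * Y ^ 0).trace := by
    rw [pow_zero, Matrix.mul_one, Matrix.mul_assoc, Matrix.trace_mul_comm]
  have e2 : (H * H * Y ^ (2 * p)).trace = (H * X ^ 0 * H * Y ^ (2 * p)).trace := by
    rw [pow_zero, Matrix.mul_one]
  rw [e1, e2, hUp, hVp, hUp (2 * p), hVp 0, hUp 0, hVp (2 * p)]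
  simp only [trace_diagonalization H U V hH]
  rw [← Finset.sum_add_distrib]
  refine Finset.sum_le_sum fun i _ => ?_
  rw [← Finset.sum_add_distrib]
  refine Finset.sum_le_sum fun b _ => ?_
  rw [← mul_add]
  refine mul_le_mul_of_nonneg_left ?_ (sq_nonneg _)
  simpa using abs_pow_mul_pow_le (l b) (m i) j k p h

/-- The trace is the sum over the columns `z` of `Z` of the quadratic form `z ⬝ᵥ P z`, and
Cauchy–Schwarz bounds each term. -/
theorem trace_transpose_mul_mul_le (P Z : Matrix n n ℝ) :
    (Z.transpose * P * Z).trace ≤ ‖P‖ * (Z.transpose * Z).trace := by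
  have key : ∀ v : n → ℝ, v ⬝ᵥ P.mulVec v ≤ ‖P‖ * (v ⬝ᵥ v) := by
    intro v
    have h1 := mulVec_dotProduct_le P v
    have h2 : (v ⬝ᵥ P.mulVec v) ^ 2 ≤ (v ⬝ᵥ v) * (P.mulVec v ⬝ᵥ P.mulVec v) := by
      have := Finset.sum_mul_sq_le_sq_mul_sq Finset.univ v (P.mulVec v)
      simpa [dotProduct, pow_two] using this
    have h0 : 0 ≤ v ⬝ᵥ v := by
      simp only [dotProduct]; exact Finset.sum_nonneg fun i _ => mul_self_nonneg _
    refine le_of_sq_le_sq ?_ (by positivity)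
    calc _ ≤ _ := h2
      _ ≤ (v ⬝ᵥ v) * (‖P‖ ^ 2 * (v ⬝ᵥ v)) := by gcongr
      _ = _ := by ring
  rw [Matrix.trace, Matrix.trace, Finset.mul_sum]
  refine Finset.sum_le_sum fun i _ => ?_
  have := key (fun a => Z a i)
  simp only [Matrix.diag_apply]
  convert! this using 1
  · rw [Matrix.mul_assoc, Matrix.mul_apply]
    simp [dotProduct, Matrix.mulVec, Matrix.mul_apply]

theorem trace_mul_pow_le (P X : Matrix n n ℝ) (hX : X.transpose = X) (p : ℕ) :
    (P * X ^ (2 * p)).trace ≤ ‖P‖ * (X ^ (2 * p)).trace := by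
  have h := trace_transpose_mul_mul_le P (X ^ p)
  have e : (X ^ p).transpose = X ^ p := by rw [Matrix.transpose_pow, hX]
  rw [e, ← pow_add, ← two_mul] at h
  rwa [two_mul, pow_add, ← Matrix.mul_assoc, Matrix.trace_mul_comm, ← Matrix.mul_assoc,
    ← pow_add, ← two_mul]

theorem pow_sub_pow_eq_sum {R : Type*} [Ring R] (X Y : R) (N : ℕ) :
    X ^ N - Y ^ N = ∑ j ∈ Finset.range N, X ^ j * (X - Y) * Y ^ (N - 1 - j) := by
  induction N with
  | zero => simp
  | succ N ih =>
    rw [Finset.sum_range_succ']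
    have : ∑ k ∈ Finset.range N, X ^ (k + 1) * (X - Y) * Y ^ (N + 1 - 1 - (k + 1)) =
        X * (X ^ N - Y ^ N) := by
      rw [ih, Finset.mul_sum]
      refine Finset.sum_congr rfl fun k hk => ?_
      rw [pow_succ', show N + 1 - 1 - (k + 1) = N - 1 - k by omega]
      simp only [mul_assoc]
    rw [this]
    simp only [pow_succ', pow_zero, one_mul, Nat.add_sub_cancel, Nat.sub_zero]
    noncomm_ring

end Khintchine

/-! ### Averages over random signs -/

section Signs

variable {ι : Type*} [Fintype ι] [DecidableEq ι]

/-- The real number `±1` underlying a sign. -/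
def sgn (u : ℤˣ) : ℝ := ((u : ℤ) : ℝ)

@[simp] theorem sgn_one : sgn 1 = 1 := by simp [sgn]
@[simp] theorem sgn_neg (u : ℤˣ) : sgn (-u) = -sgn u := by simp [sgn]
@[simp] theorem sgn_mul_self (u : ℤˣ) : sgn u * sgn u = 1 := by
  rcases Int.units_eq_one_or u with h | h <;> simp [h]
@[simp] theorem sgn_sq (u : ℤˣ) : sgn u ^ 2 = 1 := by rw [pow_two, sgn_mul_self]

/-- The average of a function over all choices of signs. -/
noncomputable def signAvg (f : (ι → ℤˣ) → ℝ) : ℝ :=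
  (Fintype.card (ι → ℤˣ) : ℝ)⁻¹ * ∑ ε, f ε

theorem signAvg_mono {f g : (ι → ℤˣ) → ℝ} (h : ∀ ε, f ε ≤ g ε) : signAvg f ≤ signAvg g := by
  unfold signAvg
  gcongr
  exact h _

theorem signAvg_const (c : ℝ) : signAvg (fun _ : ι → ℤˣ => c) = c := by
  unfold signAvg
  rw [Finset.sum_const, Finset.card_univ, nsmul_eq_mul, inv_mul_cancel_left₀]
  exact_mod_cast Fintype.card_ne_zero

theorem signAvg_add (f g : (ι → ℤˣ) → ℝ) :
    signAvg (fun ε => f ε + g ε) = signAvg f + signAvg g := by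
  simp [signAvg, Finset.sum_add_distrib, mul_add]

theorem signAvg_sub (f g : (ι → ℤˣ) → ℝ) :
    signAvg (fun ε => f ε - g ε) = signAvg f - signAvg g := by
  simp [signAvg, Finset.sum_sub_distrib, mul_sub]

theorem signAvg_const_mul (c : ℝ) (f : (ι → ℤˣ) → ℝ) :
    signAvg (fun ε => c * f ε) = c * signAvg f := by
  simp only [signAvg, ← Finset.mul_sum]; ring

theorem signAvg_mul_const (c : ℝ) (f : (ι → ℤˣ) → ℝ) :
    signAvg (fun ε => f ε * c) = signAvg f * c := by
  simp only [signAvg, ← Finset.sum_mul]; ring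

theorem signAvg_sum {κ : Type*} (s : Finset κ) (f : κ → (ι → ℤˣ) → ℝ) :
    signAvg (fun ε => ∑ i ∈ s, f i ε) = ∑ i ∈ s, signAvg (f i) := by
  simp only [signAvg, Finset.mul_sum]
  rw [Finset.sum_comm]

theorem signAvg_flip (i : ι) (f : (ι → ℤˣ) → ℝ) :
    signAvg (fun ε => f (Function.update ε i (-ε i))) = signAvg f := by
  unfold signAvg
  congr 1
  have hinv : Function.Involutive fun ε : ι → ℤˣ => Function.update ε i (-ε i) := by
    intro ε; simp
  exact Equiv.sum_comp hinv.toPerm f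

theorem signAvg_pow_le (f : (ι → ℤˣ) → ℝ) (hf : ∀ ε, 0 ≤ f ε) (p : ℕ) :
    signAvg f ^ p ≤ signAvg fun ε => f ε ^ p := by
  have := Real.pow_arith_mean_le_arith_mean_pow Finset.univ
    (fun _ : ι → ℤˣ => (Fintype.card (ι → ℤˣ) : ℝ)⁻¹) f (fun _ _ => by positivity)
    (by rw [Finset.sum_const, Finset.card_univ, nsmul_eq_mul, mul_inv_cancel₀]
        exact_mod_cast Fintype.card_ne_zero) (fun _ _ => hf _) p
  simpa [signAvg, Finset.mul_sum] using this

/-- The signed sum `∑ i, ε i • A i`. -/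
noncomputable def signSum {E : Type*} [AddCommGroup E] [Module ℝ E] (A : ι → E)
    (ε : ι → ℤˣ) : E := ∑ i, sgn (ε i) • A i

theorem signSum_sub_flip {E : Type*} [AddCommGroup E] [Module ℝ E] (A : ι → E)
    (ε : ι → ℤˣ) (i : ι) :
    signSum A ε - signSum A (Function.update ε i (-ε i)) = (2 * sgn (ε i)) • A i := by
  unfold signSum
  rw [← Finset.sum_sub_distrib, Finset.sum_eq_single i]
  · simp [two_mul, add_smul]
  · intro j _ hj; simp [hj]
  · simp

end Signs

/-! ### Trace moments and the symmetric Khintchine inequality -/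

section Moments

variable {ι n : Type*} [Fintype ι] [DecidableEq ι] [Fintype n] [DecidableEq n]

theorem signSum_transpose (H : ι → Matrix n n ℝ) (hH : ∀ i, (H i).transpose = H i)
    (ε : ι → ℤˣ) : (signSum H ε).transpose = signSum H ε := by
  simp [signSum, Matrix.transpose_sum, hH]

/-- Telescoping `X^(2p+1) - Y^(2p+1)` gives `2p+1` terms, each containing `X - Y = 2 ε_i H_i`. The
two factors `ε_i` cancel, and `trace_mul_pow_mul_pow_le` bounds every term by the same quantity. -/
theorem trace_diff_le (H : ι → Matrix n n ℝ) (hH : ∀ i, (H i).transpose = H i)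
    (ε : ι → ℤˣ) (i : ι) (p : ℕ) :
    sgn (ε i) * ((H i * signSum H ε ^ (2 * p + 1)).trace -
        (H i * signSum H (Function.update ε i (-ε i)) ^ (2 * p + 1)).trace) ≤
      2 * (2 * p + 1) * ((H i * H i * signSum H ε ^ (2 * p)).trace +
        (H i * H i * signSum H (Function.update ε i (-ε i)) ^ (2 * p)).trace) := by
  set X := signSum H ε
  set Y := signSum H (Function.update ε i (-ε i))
  have hX : X.transpose = X := signSum_transpose H hH _
  have hY : Y.transpose = Y := signSum_transpose H hH _
  have hXY : X - Y = (2 * sgn (ε i)) • H i := signSum_sub_flip H ε i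
  rw [← Matrix.trace_sub, ← Matrix.mul_sub, pow_sub_pow_eq_sum, hXY, Matrix.mul_sum,
    Matrix.trace_sum, Finset.mul_sum]
  have : ∀ j ∈ Finset.range (2 * p + 1), sgn (ε i) *
      (H i * (X ^ j * (2 * sgn (ε i)) • H i * Y ^ (2 * p + 1 - 1 - j))).trace ≤
      2 * ((H i * H i * X ^ (2 * p)).trace + (H i * H i * Y ^ (2 * p)).trace) := by
    intro j hj
    have h := trace_mul_pow_mul_pow_le (H i) X Y (hH i) hX hY j (2 * p - j) p
      (by rw [Finset.mem_range] at hj; omega)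
    have e : sgn (ε i) *
      (H i * (X ^ j * (2 * sgn (ε i)) • H i * Y ^ (2 * p + 1 - 1 - j))).trace =
      2 * (H i * X ^ j * H i * Y ^ (2 * p - j)).trace := by
      rw [Matrix.mul_smul, Matrix.smul_mul, Matrix.mul_smul, Matrix.trace_smul, smul_eq_mul,
        Nat.add_sub_cancel]
      simp only [← Matrix.mul_assoc]
      linear_combination (2 * (H i * X ^ j * H i * Y ^ (2 * p - j)).trace) * sgn_mul_self (ε i)
    rw [e]
    linarith
  refine (Finset.sum_le_sum this).trans (le_of_eq ?_)
  rw [Finset.sum_const, Finset.card_range, nsmul_eq_mul]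
  push_cast
  ring

/-- A discrete integration by parts. One factor of the power is expanded as `∑ ε_i H_i`. Flipping
`ε_i` preserves the average, so the mean of `ε_i tr(H_i X^(2p+1))` is half the mean of the
difference estimated in `trace_diff_le`. -/
theorem signAvg_trace_pow_succ_le (H : ι → Matrix n n ℝ) (hH : ∀ i, (H i).transpose = H i)
    (p : ℕ) :
    signAvg (fun ε => (signSum H ε ^ (2 * (p + 1))).trace) ≤
      2 * (2 * p + 1) * ‖∑ i, H i * H i‖ * signAvg (fun ε => (signSum H ε ^ (2 * p)).trace) := by
  have h1 : ∀ ε, (signSum H ε ^ (2 * (p + 1))).trace =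
      ∑ i, sgn (ε i) * (H i * signSum H ε ^ (2 * p + 1)).trace := by
    intro ε
    rw [show 2 * (p + 1) = (2 * p + 1) + 1 by ring, pow_succ' _ (2 * p + 1)]
    conv_lhs => enter [1, 1]; rw [signSum]
    rw [Matrix.sum_mul, Matrix.trace_sum]
    simp [Matrix.trace_smul]
  have h2 : ∀ i, signAvg (fun ε => sgn (ε i) * (H i * signSum H ε ^ (2 * p + 1)).trace) ≤
      2 * (2 * p + 1) * signAvg (fun ε => (H i * H i * signSum H ε ^ (2 * p)).trace) := by
    intro i
    have a1 := signAvg_flip i fun ε : ι → ℤˣ =>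
      sgn (ε i) * (H i * signSum H ε ^ (2 * p + 1)).trace
    have a2 := signAvg_flip i fun ε : ι → ℤˣ => (H i * H i * signSum H ε ^ (2 * p)).trace
    have a3 := signAvg_mono fun ε => trace_diff_le H hH ε i p
    -- The flip also identifies the averages of the two terms on the right.
    rw [signAvg_const_mul, signAvg_add, a2] at a3
    simp only [mul_sub] at a3
    rw [signAvg_sub] at a3
    simp only [Function.update_self, sgn_neg] at a1
    have a4 : signAvg (fun ε : ι → ℤˣ => -sgn (ε i) *
        (H i * signSum H (Function.update ε i (-ε i)) ^ (2 * p + 1)).trace) =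
        - signAvg (fun ε : ι → ℤˣ => sgn (ε i) *
        (H i * signSum H (Function.update ε i (-ε i)) ^ (2 * p + 1)).trace) := by
      rw [← neg_one_mul, ← signAvg_const_mul]
      congr 1; funext ε; ring
    linarith
  simp only [h1]
  rw [signAvg_sum]
  refine (Finset.sum_le_sum fun i _ => h2 i).trans ?_
  rw [← Finset.mul_sum, ← signAvg_sum, mul_assoc (2 * (2 * (p : ℝ) + 1)),
    ← signAvg_const_mul ‖∑ i, H i * H i‖]
  refine mul_le_mul_of_nonneg_left (signAvg_mono fun ε => ?_) (by positivity)
  rw [← Matrix.trace_sum, ← Matrix.sum_mul]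
  exact trace_mul_pow_le _ _ (signSum_transpose H hH ε) p

theorem trace_pow_nonneg (X : Matrix n n ℝ) (hX : X.transpose = X) (p : ℕ) :
    0 ≤ (X ^ (2 * p)).trace := by
  have : X ^ (2 * p) = (X ^ p).transpose * X ^ p := by
    rw [Matrix.transpose_pow, hX, ← pow_add, two_mul]
  rw [this, Matrix.trace]
  refine Finset.sum_nonneg fun i _ => ?_
  rw [Matrix.diag_apply, Matrix.mul_apply]
  exact Finset.sum_nonneg fun j _ => mul_self_nonneg _

theorem signAvg_trace_pow_le (H : ι → Matrix n n ℝ) (hH : ∀ i, (H i).transpose = H i)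
    (p N : ℕ) (hp : p ≤ N) :
    signAvg (fun ε => (signSum H ε ^ (2 * p)).trace) ≤
      (4 * N * ‖∑ i, H i * H i‖) ^ p * Fintype.card n := by
  induction p with
  | zero => simp [signAvg_const]
  | succ p ih =>
    refine (signAvg_trace_pow_succ_le H hH p).trans ?_
    have hN : (p : ℝ) + 1 ≤ N := by exact_mod_cast hp
    have h0 : 0 ≤ signAvg (fun ε => (signSum H ε ^ (2 * p)).trace) := by
      have := signAvg_mono (f := fun _ : ι → ℤˣ => 0)
        fun ε => trace_pow_nonneg _ (signSum_transpose H hH ε) p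
      rwa [signAvg_const] at this
    calc _ ≤ 4 * N * ‖∑ i, H i * H i‖ * signAvg (fun ε => (signSum H ε ^ (2 * p)).trace) := by
          gcongr ?_ * _ * _; linarith
      _ ≤ 4 * N * ‖∑ i, H i * H i‖ *
          ((4 * N * ‖∑ i, H i * H i‖) ^ p * Fintype.card n) := by gcongr; exact ih (by omega)
      _ = _ := by ring

theorem opNorm_sq_le_trace (B : Matrix n n ℝ) : ‖B‖ ^ 2 ≤ (B.transpose * B).trace := by
  have h0 : 0 ≤ (B.transpose * B).trace := by
    rw [Matrix.trace]
    refine Finset.sum_nonneg fun i _ => ?_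
    rw [Matrix.diag_apply, Matrix.mul_apply]
    exact Finset.sum_nonneg fun j _ => mul_self_nonneg _
  rw [← Real.sq_sqrt h0]
  gcongr
  refine opNorm_le_of_mulVec B (Real.sqrt_nonneg _) fun v => ?_
  rw [Real.sq_sqrt h0]
  simp only [Matrix.trace, Matrix.diag_apply, Matrix.mul_apply, Matrix.transpose_apply,
    dotProduct, Matrix.mulVec]
  rw [Finset.sum_comm, Finset.sum_mul]
  refine Finset.sum_le_sum fun i _ => ?_
  have := Finset.sum_mul_sq_le_sq_mul_sq Finset.univ (B i) v
  simpa [pow_two] using this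

/-- The exponent is restricted to powers of two because for these the C*-identity, iterated, yields
`‖X ^ 2 ^ k‖ = ‖X‖ ^ 2 ^ k`. -/
theorem opNorm_pow_le_trace (X : Matrix n n ℝ) (hX : X.transpose = X) (k : ℕ) :
    ‖X‖ ^ (2 * 2 ^ k) ≤ (X ^ (2 * 2 ^ k)).trace := by
  have hs : IsSelfAdjoint X := by
    rw [IsSelfAdjoint, Matrix.star_eq_conjTranspose,
      Matrix.conjTranspose_eq_transpose_of_trivial, hX]
  have h1 : ‖X ^ 2 ^ k‖ = ‖X‖ ^ 2 ^ k := by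
    have := hs.nnnorm_pow_two_pow k
    exact congrArg NNReal.toReal this
  have h2 := opNorm_sq_le_trace (X ^ 2 ^ k)
  rw [h1, Matrix.transpose_pow, hX, ← pow_mul, ← pow_add, ← two_mul, mul_comm (2 ^ k)] at h2
  exact h2

theorem signAvg_opNorm_le_of_transpose (H : ι → Matrix n n ℝ)
    (hH : ∀ i, (H i).transpose = H i) {l : ℝ} (hl : 1 ≤ l)
    (hn : (Fintype.card n : ℝ) ≤ Real.exp l) :
    signAvg (fun ε => ‖signSum H ε‖) ≤ 8 * √l * √‖∑ i, H i * H i‖ := by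
  -- The moment used is `2N` with `N` a power of two between `l` and `2l`: large enough that the
  -- dimension is at most `exp N`, small enough that `√N` is of order `√l`.
  obtain ⟨k, hk1, hk2⟩ := exists_nat_pow_near hl (one_lt_two)
  set v := ‖∑ i, H i * H i‖ with hv
  set N := 2 ^ (k + 1) with hN
  have hNl : (N : ℝ) ≤ 2 * l := by rw [hN]; push_cast; rw [pow_succ]; linarith
  have hlN : l ≤ (N : ℝ) := by rw [hN]; push_cast; exact hk2.le
  have hs0 : 0 ≤ signAvg (fun ε => ‖signSum H ε‖) := by
    have := signAvg_mono (f := fun _ : ι → ℤˣ => 0) fun ε => norm_nonneg (signSum H ε)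
    rwa [signAvg_const] at this
  have h1 : (signAvg (fun ε => ‖signSum H ε‖) ^ 2) ^ N ≤ (Real.exp 1 * (4 * N * v)) ^ N := by
    rw [← pow_mul]
    calc _ ≤ signAvg (fun ε => ‖signSum H ε‖ ^ (2 * N)) :=
          signAvg_pow_le _ (fun _ => norm_nonneg _) _
      _ ≤ signAvg (fun ε => (signSum H ε ^ (2 * N)).trace) :=
          signAvg_mono fun ε => opNorm_pow_le_trace _ (signSum_transpose H hH ε) _
      _ ≤ (4 * N * v) ^ N * Fintype.card n := signAvg_trace_pow_le H hH N N le_rfl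
      _ ≤ (4 * N * v) ^ N * Real.exp 1 ^ N := by
          gcongr
          rw [← Real.exp_nat_mul, mul_one]
          exact hn.trans (Real.exp_le_exp.mpr hlN)
      _ = _ := by rw [mul_pow (Real.exp 1), mul_comm]
  have h2 := le_of_pow_le_pow_left₀ (by positivity : N ≠ 0) (by positivity) h1
  refine le_of_sq_le_sq (h2.trans ?_) (by positivity)
  rw [mul_pow, mul_pow, Real.sq_sqrt (by linarith), Real.sq_sqrt (norm_nonneg _)]
  have he : Real.exp 1 ≤ 3 := by linarith [Real.exp_one_lt_d9]
  calc Real.exp 1 * (4 * N * v) ≤ 3 * (4 * (2 * l) * v) := by gcongr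
    _ ≤ _ := by have : 0 ≤ l * v := by positivity
                nlinarith

end Moments

/-! ### Stacked matrices, dilation, rectangular Khintchine -/

section Stack

variable {ι I J : Type*} [Fintype ι] [DecidableEq ι] [Fintype I] [DecidableEq I]
  [Fintype J] [DecidableEq J]

/-- The matrices `A i` stacked on top of each other. -/
def rowStack (A : ι → Matrix I J ℝ) : Matrix (ι × I) J ℝ := Matrix.of fun p y => A p.1 p.2 y

/-- The matrices `A i` side by side. -/
def colStack (A : ι → Matrix I J ℝ) : Matrix I (ι × J) ℝ := Matrix.of fun x p => A p.1 x p.2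

theorem rowStack_transpose (A : ι → Matrix I J ℝ) :
    rowStack (fun i => (A i).transpose) = (colStack A).transpose := rfl

theorem norm_rowStack_transpose (A : ι → Matrix I J ℝ) :
    ‖rowStack (fun i => (A i).transpose)‖ = ‖colStack A‖ := by
  rw [rowStack_transpose, opNorm_transpose]

theorem rowStack_gram (A : ι → Matrix I J ℝ) :
    (rowStack A).transpose * rowStack A = ∑ i, (A i).transpose * A i := by
  ext x y
  simp [rowStack, Matrix.mul_apply, Fintype.sum_prod_type, Matrix.sum_apply]

theorem norm_sum_gram (A : ι → Matrix I J ℝ) :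
    ‖∑ i, (A i).transpose * A i‖ = ‖rowStack A‖ ^ 2 := by
  rw [← rowStack_gram, opNorm_transpose_mul_self]

theorem rowStack_mulVec (A : ι → Matrix I J ℝ) (v : J → ℝ) :
    ((rowStack A).mulVec v) ⬝ᵥ ((rowStack A).mulVec v) =
      ∑ i, ((A i).mulVec v) ⬝ᵥ ((A i).mulVec v) := by
  simp [rowStack, Matrix.mulVec, dotProduct, Fintype.sum_prod_type]

/-- The Hermitian dilation of a rectangular matrix. -/
def dilation (A : Matrix I J ℝ) : Matrix (I ⊕ J) (I ⊕ J) ℝ :=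
  Matrix.fromBlocks 0 A A.transpose 0

theorem norm_le_norm_dilation (A : Matrix I J ℝ) : ‖A‖ ≤ ‖dilation A‖ := by
  refine opNorm_le_of_mulVec _ (norm_nonneg _) fun v => ?_
  have := mulVec_dotProduct_le (dilation A) (Sum.elim 0 v)
  simpa [dilation, Matrix.fromBlocks_mulVec, dotProduct] using this

theorem norm_blockDiagonal_le (P : Matrix I I ℝ) (Q : Matrix J J ℝ) :
    ‖Matrix.fromBlocks P 0 0 Q‖ ≤ max ‖P‖ ‖Q‖ := by
  refine opNorm_le_of_mulVec _ (by positivity) fun v => ?_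
  have hv : v = Sum.elim (v ∘ Sum.inl) (v ∘ Sum.inr) := by ext (x | x) <;> rfl
  have h1 := mulVec_dotProduct_le P (v ∘ Sum.inl)
  have h2 := mulVec_dotProduct_le Q (v ∘ Sum.inr)
  have n1 : 0 ≤ (v ∘ Sum.inl) ⬝ᵥ (v ∘ Sum.inl : I → ℝ) :=
    Finset.sum_nonneg fun j _ => mul_self_nonneg _
  have n2 : 0 ≤ (v ∘ Sum.inr) ⬝ᵥ (v ∘ Sum.inr : J → ℝ) :=
    Finset.sum_nonneg fun j _ => mul_self_nonneg _
  rw [Matrix.fromBlocks_mulVec]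
  simp only [Matrix.zero_mulVec, add_zero, zero_add]
  rw [sumElim_dotProduct_sumElim]
  have e : v ⬝ᵥ v = (v ∘ Sum.inl) ⬝ᵥ (v ∘ Sum.inl : I → ℝ) +
      (v ∘ Sum.inr) ⬝ᵥ (v ∘ Sum.inr : J → ℝ) := by simp [dotProduct]
  rw [e, mul_add]
  refine add_le_add (h1.trans ?_) (h2.trans ?_)
  · gcongr; exact le_max_left _ _
  · gcongr; exact le_max_right _ _

/-- The noncommutative Khintchine inequality. -/
theorem signAvg_opNorm_le (A : ι → Matrix I J ℝ) {l : ℝ} (hl : 1 ≤ l)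
    (hn : (Fintype.card I + Fintype.card J : ℝ) ≤ Real.exp l) :
    signAvg (fun ε => ‖signSum A ε‖) ≤ 8 * √l * (‖rowStack A‖ + ‖colStack A‖) := by
  have h1 : ∀ ε, dilation (signSum A ε) = signSum (fun i => dilation (A i)) ε := by
    intro ε
    ext (x | x) (y | y) <;> simp [dilation, signSum, Matrix.sum_apply]
  have h2 : ∀ i, (dilation (A i)).transpose = dilation (A i) := by
    intro i; simp [dilation, Matrix.fromBlocks_transpose]
  -- The two diagonal blocks are the Gram matrices of the column stack and the row stack, so their
  -- norms are squares of stack norms.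
  have h3 : ∑ i, dilation (A i) * dilation (A i) =
      Matrix.fromBlocks (∑ i, A i * (A i).transpose) 0 0 (∑ i, (A i).transpose * A i) := by
    ext (x | x) (y | y) <;> simp [dilation, Matrix.fromBlocks_multiply, Matrix.sum_apply]
  have h4 := signAvg_opNorm_le_of_transpose (fun i => dilation (A i)) h2 hl
    (by simpa using hn)
  calc _ ≤ signAvg (fun ε => ‖signSum (fun i => dilation (A i)) ε‖) :=
        signAvg_mono fun ε => by rw [← h1]; exact norm_le_norm_dilation _
    _ ≤ _ := h4
    _ ≤ _ := by
      gcongr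
      rw [h3]
      refine (Real.sqrt_le_sqrt (norm_blockDiagonal_le _ _)).trans ?_
      have e1 := norm_sum_gram A
      have e2 := norm_sum_gram fun i => (A i).transpose
      simp only [Matrix.transpose_transpose] at e2
      rw [e1, e2, norm_rowStack_transpose]
      refine Real.sqrt_le_iff.mpr ⟨by positivity, max_le ?_ ?_⟩
      · gcongr; exact le_add_of_nonneg_left (norm_nonneg _)
      · gcongr; exact le_add_of_nonneg_right (norm_nonneg _)

end Stack

/-! ### Khintchine's lower bound in a Hilbert space -/

section HilbertKhintchine

variable {ι : Type*} [Fintype ι] [DecidableEq ι]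
  {E : Type*} [NormedAddCommGroup E] [InnerProductSpace ℝ E]

theorem signAvg_sgn_mul_eq_zero (i : ι) (f : (ι → ℤˣ) → ℝ)
    (hf : ∀ ε, f (Function.update ε i (-ε i)) = f ε) :
    signAvg (fun ε => sgn (ε i) * f ε) = 0 := by
  have h := signAvg_flip i fun ε => sgn (ε i) * f ε
  simp only [Function.update_self, sgn_neg, hf] at h
  have e : signAvg (fun ε => -sgn (ε i) * f ε) = -signAvg fun ε => sgn (ε i) * f ε := by
    rw [← neg_one_mul, ← signAvg_const_mul]
    congr 1; funext ε; ring
  linarith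

/-- Induction on `s`: terms odd in the new sign average to zero. In the fourth moment, `(‖X‖² +
‖a‖²)² + 4⟨X, a⟩²` is at most `‖X‖⁴ + 6‖X‖²‖a‖² + ‖a‖⁴`, and the middle coefficient is what the
constant `3` can absorb. -/
theorem signAvg_moments (a : ι → E) (s : Finset ι) :
    signAvg (fun ε => ‖∑ i ∈ s, sgn (ε i) • a i‖ ^ 2) = ∑ i ∈ s, ‖a i‖ ^ 2 ∧
    signAvg (fun ε => (‖∑ i ∈ s, sgn (ε i) • a i‖ ^ 2) ^ 2) ≤ 3 * (∑ i ∈ s, ‖a i‖ ^ 2) ^ 2 := by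
  induction s using Finset.induction_on with
  | empty => simp [signAvg_const]
  | insert i s hi ih =>
    obtain ⟨ih1, ih2⟩ := ih
    set X : (ι → ℤˣ) → E := fun ε => ∑ j ∈ s, sgn (ε j) • a j with hX
    have hinv : ∀ ε, X (Function.update ε i (-ε i)) = X ε := by
      intro ε
      refine Finset.sum_congr rfl fun j hj => ?_
      rw [Function.update_of_ne (by rintro rfl; exact hi hj)]
    have e1 : ∀ ε : ι → ℤˣ, ‖∑ j ∈ insert i s, sgn (ε j) • a j‖ ^ 2 =
        (‖X ε‖ ^ 2 + ‖a i‖ ^ 2) + sgn (ε i) * (2 * inner ℝ (X ε) (a i)) := by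
      intro ε
      rw [Finset.sum_insert hi, add_comm, norm_add_sq_real, norm_smul, mul_pow, inner_smul_right,
        Real.norm_eq_abs, sq_abs, sgn_sq]
      ring
    have e2 : ∀ ε : ι → ℤˣ, (‖∑ j ∈ insert i s, sgn (ε j) • a j‖ ^ 2) ^ 2 =
        ((‖X ε‖ ^ 2 + ‖a i‖ ^ 2) ^ 2 + 4 * (inner ℝ (X ε) (a i)) ^ 2) +
        sgn (ε i) * (4 * (‖X ε‖ ^ 2 + ‖a i‖ ^ 2) * inner ℝ (X ε) (a i)) := by
      intro ε
      rw [e1]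
      linear_combination (4 * (inner ℝ (X ε) (a i)) ^ 2) * sgn_sq (ε i)
    simp only [e1] at ih1 ih2 ⊢
    have e3 : ∀ ε : ι → ℤˣ, ((‖X ε‖ ^ 2 + ‖a i‖ ^ 2) + sgn (ε i) * (2 * inner ℝ (X ε) (a i))) ^ 2 =
        ((‖X ε‖ ^ 2 + ‖a i‖ ^ 2) ^ 2 + 4 * (inner ℝ (X ε) (a i)) ^ 2) +
        sgn (ε i) * (4 * (‖X ε‖ ^ 2 + ‖a i‖ ^ 2) * inner ℝ (X ε) (a i)) := by
      intro ε; rw [← e2, e1]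
    simp only [e3]
    rw [signAvg_add, signAvg_sgn_mul_eq_zero i _ (fun ε => by rw [hinv]), signAvg_add, ih1,
      signAvg_const, signAvg_add _ fun ε => sgn (ε i) * _,
      signAvg_sgn_mul_eq_zero i _ (fun ε => by rw [hinv]), Finset.sum_insert hi]
    refine ⟨by ring, ?_⟩
    set S := ∑ j ∈ s, ‖a j‖ ^ 2
    calc _ ≤ signAvg (fun ε => (‖X ε‖ ^ 2) ^ 2 + ‖X ε‖ ^ 2 * (6 * ‖a i‖ ^ 2) +
            (‖a i‖ ^ 2) ^ 2) + 0 := by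
          gcongr
          refine signAvg_mono fun ε => ?_
          have := abs_real_inner_le_norm (X ε) (a i)
          have h2 := sq_le_sq₀ (abs_nonneg _) (by positivity) |>.mpr this
          rw [sq_abs, mul_pow] at h2
          nlinarith
      _ ≤ _ := by
          rw [signAvg_add, signAvg_add, signAvg_mul_const, ih1, signAvg_const]
          have : 0 ≤ (‖a i‖ ^ 2) ^ 2 := by positivity
          nlinarith

theorem sqrt_sum_sq_le_signAvg (a : ι → E) :
    √(∑ i, ‖a i‖ ^ 2) ≤ 2 * signAvg (fun ε => ‖signSum a ε‖) := by
  obtain ⟨h1, h2⟩ := signAvg_moments a Finset.univ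
  set s := √(∑ i, ‖a i‖ ^ 2) with hs
  have hS : ∑ i, ‖a i‖ ^ 2 = s ^ 2 := (Real.sq_sqrt (by positivity)).symm
  rw [hS] at h1 h2
  have hs0 : 0 ≤ s := Real.sqrt_nonneg _
  have hm0 : 0 ≤ signAvg (fun ε => ‖signSum a ε‖) := by
    have := signAvg_mono (f := fun _ : ι → ℤˣ => 0) fun ε => norm_nonneg (signSum a ε)
    rwa [signAvg_const] at this
  rcases hs0.eq_or_lt with h0 | h0
  · rw [← h0]; positivity
  -- A polynomial minorant of `z` built from `z²` and `z⁴`. With moments `s²` and at most `3 s⁴`,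
  -- the left side averages to at least `s⁴ / 2`, whence the factor `2`. Its proof is that `z (z -
  -- 3s/2)² (z + 3s)` is nonnegative.
  have key : ∀ ε, s ^ 2 * ‖signSum a ε‖ ^ 2 - 1 / 6 * (‖signSum a ε‖ ^ 2) ^ 2 ≤
      s ^ 3 * ‖signSum a ε‖ := by
    intro ε
    set z := ‖signSum a ε‖
    have hz : 0 ≤ z := norm_nonneg _
    have : 0 ≤ z * ((z - 3 / 2 * s) ^ 2 * (z + 3 * s)) := by positivity
    have h4 : 0 ≤ z ^ 4 := by positivity
    nlinarith
  have h3 := signAvg_mono key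
  rw [signAvg_sub, signAvg_const_mul, signAvg_const_mul, signAvg_const_mul] at h3
  unfold signSum at h3 hm0 ⊢
  rw [h1] at h3
  have h4 : s ^ 3 * s ≤ s ^ 3 * (2 * signAvg (fun ε => ‖∑ i, sgn (ε i) • a i‖)) := by nlinarith
  exact le_of_mul_le_mul_left h4 (by positivity)

end HilbertKhintchine

/-! ### A stack is dominated by the signed sum -/

section MatrixLower

variable {ι I J : Type*} [Fintype ι] [DecidableEq ι] [Fintype I] [DecidableEq I]
  [Fintype J] [DecidableEq J]

theorem norm_toLp_sq (v : I → ℝ) : ‖WithLp.toLp 2 v‖ ^ 2 = v ⬝ᵥ v := by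
  rw [EuclideanSpace.norm_sq_eq]; simp [dotProduct, ← pow_two]

/-- For fixed `v`, the Hilbert space bound applies to the vectors `A_i v`. The supremum over `v` is
taken outside the average, so no dimensional factor appears. -/
theorem norm_rowStack_le_signAvg (A : ι → Matrix I J ℝ) :
    ‖rowStack A‖ ≤ 2 * signAvg (fun ε => ‖signSum A ε‖) := by
  have hm0 : 0 ≤ signAvg (fun ε => ‖signSum A ε‖) := by
    have := signAvg_mono (f := fun _ : ι → ℤˣ => 0) fun ε => norm_nonneg (signSum A ε)
    rwa [signAvg_const] at this
  refine opNorm_le_of_mulVec _ (by positivity) fun v => ?_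
  rw [rowStack_mulVec]
  have h := sqrt_sum_sq_le_signAvg fun i => WithLp.toLp 2 ((A i).mulVec v)
  have h2 : signAvg (fun ε => ‖signSum (fun i => WithLp.toLp 2 ((A i).mulVec v)) ε‖) ≤
      signAvg (fun ε => ‖signSum A ε‖) * ‖WithLp.toLp 2 v‖ := by
    rw [← signAvg_mul_const]
    refine signAvg_mono fun ε => ?_
    have e : signSum (fun i => WithLp.toLp 2 ((A i).mulVec v)) ε =
        WithLp.toLp 2 ((signSum A ε).mulVec v) := by
      simp only [signSum, Matrix.sum_mulVec, Matrix.smul_mulVec, WithLp.toLp_sum,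
        WithLp.toLp_smul]
    rw [e]
    exact (signSum A ε).l2_opNorm_mulVec (WithLp.toLp 2 v)
  simp only [norm_toLp_sq] at h
  have h3 := pow_le_pow_left₀ (Real.sqrt_nonneg _) (h.trans (mul_le_mul_of_nonneg_left h2 zero_le_two)) 2
  rw [Real.sq_sqrt (Finset.sum_nonneg fun i _ => by
    rw [← norm_toLp_sq]; positivity), ← mul_assoc, mul_pow _ ‖_‖, norm_toLp_sq] at h3
  exact h3

end MatrixLower

/-! ### Flattenings along arbitrary index maps -/

section Flat

variable {K I J I' J' : Type*} [Fintype K] [Fintype I] [DecidableEq I] [Fintype J] [DecidableEq J]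
  [Fintype I'] [DecidableEq I'] [Fintype J'] [DecidableEq J']

/-- The array `a` indexed by `K`, arranged as a matrix in which `k` sits in row `ρ k` and in column
`γ k`. -/
def flat (ρ : K → I) (γ : K → J) (a : K → ℝ) : Matrix I J ℝ :=
  Matrix.of fun x y => ∑ k, if ρ k = x ∧ γ k = y then a k else 0

theorem flat_transpose (ρ : K → I) (γ : K → J) (a : K → ℝ) :
    (flat ρ γ a).transpose = flat γ ρ a := by
  ext x y; simp [flat, and_comm]

theorem norm_flat_comm (ρ : K → I) (γ : K → J) (a : K → ℝ) :
    ‖flat ρ γ a‖ = ‖flat γ ρ a‖ := by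
  rw [← flat_transpose, opNorm_transpose]

theorem flat_mulVec (ρ : K → I) (γ : K → J) (a : K → ℝ) (v : J → ℝ) (x : I) :
    (flat ρ γ a).mulVec v x = ∑ k, if ρ k = x then a k * v (γ k) else 0 := by
  simp only [flat, Matrix.mulVec, dotProduct, Matrix.of_apply, Finset.sum_mul]
  rw [Finset.sum_comm]
  refine Finset.sum_congr rfl fun k _ => ?_
  rw [Finset.sum_eq_single (γ k)]
  · simp [ite_mul]
  · intro y _ hy; simp [hy.symm]
  · simp

theorem norm_flat_le_of_row (ρ : K → I) (ρ' : K → I') (γ : K → J) (a : K → ℝ)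
    (h : ∀ k k', ρ k = ρ k' ↔ ρ' k = ρ' k') : ‖flat ρ γ a‖ ≤ ‖flat ρ' γ a‖ := by
  refine opNorm_le_of_mulVec _ (norm_nonneg _) fun v => ?_
  refine le_trans ?_ (mulVec_dotProduct_le (flat ρ' γ a) v)
  have key : ∀ k, (flat ρ γ a).mulVec v (ρ k) = (flat ρ' γ a).mulVec v (ρ' k) := by
    intro k; simp only [flat_mulVec, h]
  have hz : ∀ x ∉ Finset.univ.image ρ, (flat ρ γ a).mulVec v x = 0 := by
    intro x hx
    rw [flat_mulVec]
    refine Finset.sum_eq_zero fun k _ => if_neg ?_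
    rintro rfl; exact hx (Finset.mem_image_of_mem _ (Finset.mem_univ _))
  simp only [dotProduct]
  rw [← Finset.sum_subset (Finset.subset_univ (Finset.univ.image ρ))
    (fun x _ hx => by rw [hz x hx, zero_mul])]
  -- `T` holds one representative of each fibre of `ρ`, equivalently of `ρ'`; it matches the nonzero
  -- rows on one side with distinct rows on the other.
  obtain ⟨T, -, hT⟩ := (Set.univ : Set K).exists_subset_bijOn ρ
  classical
  have hTi : Finset.univ.image ρ = T.toFinset.image ρ := by
    rw [← Finset.coe_inj]
    simpa using hT.image_eq.symm
  have inj : Set.InjOn ρ (T.toFinset : Set K) := by simpa using hT.injOn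
  have inj' : Set.InjOn ρ' (T.toFinset : Set K) := fun k hk k' hk' e =>
    inj hk hk' ((h k k').mpr e)
  rw [hTi, Finset.sum_image inj]
  simp only [key]
  rw [← Finset.sum_image (f := fun x => (flat ρ' γ a).mulVec v x * (flat ρ' γ a).mulVec v x) inj']
  exact Finset.sum_le_sum_of_subset_of_nonneg (Finset.subset_univ _)
    fun _ _ _ => mul_self_nonneg _

/-- The norm sees only the partitions of `K` into rows and columns. This allows relabelling, and
repeating a coordinate that the row or column already determines. -/
theorem norm_flat_congr (ρ : K → I) (ρ' : K → I') (γ : K → J) (γ' : K → J') (a : K → ℝ)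
    (hρ : ∀ k k', ρ k = ρ k' ↔ ρ' k = ρ' k') (hγ : ∀ k k', γ k = γ k' ↔ γ' k = γ' k') :
    ‖flat ρ γ a‖ = ‖flat ρ' γ' a‖ := by
  have h1 : ‖flat ρ γ a‖ = ‖flat ρ' γ a‖ := le_antisymm (norm_flat_le_of_row _ _ _ _ hρ)
    (norm_flat_le_of_row _ _ _ _ fun k k' => (hρ k k').symm)
  rw [h1, norm_flat_comm, norm_flat_comm ρ']
  exact le_antisymm (norm_flat_le_of_row _ _ _ _ hγ)
    (norm_flat_le_of_row _ _ _ _ fun k k' => (hγ k k').symm)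

variable {ι : Type*} [Fintype ι] [DecidableEq ι]

/-- The part of `flat ρ γ a` that comes from the `k` with `c k = i`. -/
def slice (c : K → ι) (ρ : K → I) (γ : K → J) (a : K → ℝ) (i : ι) : Matrix I J ℝ :=
  flat ρ γ fun k => if c k = i then a k else 0

theorem sum_smul_slice (c : K → ι) (ρ : K → I) (γ : K → J) (a : K → ℝ) (y : ι → ℝ) :
    ∑ i, y i • slice c ρ γ a i = flat ρ γ fun k => y (c k) * a k := by
  ext u v
  simp only [slice, flat, Matrix.sum_apply, Matrix.smul_apply, Matrix.of_apply, smul_eq_mul,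
    Finset.mul_sum]
  rw [Finset.sum_comm]
  refine Finset.sum_congr rfl fun k _ => ?_
  rw [Finset.sum_eq_single (c k)]
  · simp
  · intro i _ hi; simp [hi.symm]
  · simp

theorem rowStack_smul_slice (c : K → ι) (ρ : K → I) (γ : K → J) (a : K → ℝ) (y : ι → ℝ) :
    rowStack (fun i => y i • slice c ρ γ a i) =
      flat (fun k => (c k, ρ k)) γ fun k => y (c k) * a k := by
  ext ⟨i, u⟩ v
  simp only [slice, flat, rowStack, Matrix.smul_apply, Matrix.of_apply, smul_eq_mul,
    Finset.mul_sum, Prod.mk.injEq]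
  refine Finset.sum_congr rfl fun k _ => ?_
  by_cases h : c k = i
  · subst h; simp
  · simp [h]

theorem colStack_smul_slice (c : K → ι) (ρ : K → I) (γ : K → J) (a : K → ℝ) (y : ι → ℝ) :
    colStack (fun i => y i • slice c ρ γ a i) =
      flat ρ (fun k => (c k, γ k)) fun k => y (c k) * a k := by
  have := rowStack_smul_slice c γ ρ a y
  rw [← flat_transpose, ← this]
  ext u ⟨i, v⟩
  simp only [rowStack, colStack, Matrix.of_apply, Matrix.transpose_apply, Matrix.smul_apply,
    slice]
  rw [← flat_transpose γ ρ, Matrix.transpose_apply]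

/-- With `c` recorded in both rows and columns the matrix is block diagonal, and the slices are its
blocks. This is the source of the flattenings in `r`. -/
theorem norm_slice_le (c : K → ι) (ρ : K → I) (γ : K → J) (a : K → ℝ) (i : ι) :
    ‖slice c ρ γ a i‖ ≤ ‖flat (fun k => (c k, ρ k)) (fun k => (c k, γ k)) a‖ := by
  refine opNorm_le_of_mulVec _ (norm_nonneg _) fun v => ?_
  have h := mulVec_dotProduct_le (flat (fun k => (c k, ρ k)) (fun k => (c k, γ k)) a)
    fun p => if p.1 = i then v p.2 else 0
  have e1 : (fun p : ι × J => if p.1 = i then v p.2 else 0) ⬝ᵥ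
      (fun p : ι × J => if p.1 = i then v p.2 else 0) = v ⬝ᵥ v := by
    simp only [dotProduct]
    rw [Fintype.sum_prod_type, Finset.sum_eq_single i]
    · simp
    · intro j _ hj; simp [hj]
    · simp
  rw [e1] at h
  refine le_trans ?_ h
  have e2 : ∀ x, (slice c ρ γ a i).mulVec v x =
      (flat (fun k => (c k, ρ k)) (fun k => (c k, γ k)) a).mulVec
        (fun p => if p.1 = i then v p.2 else 0) (i, x) := by
    intro x
    rw [slice, flat_mulVec, flat_mulVec]
    refine Finset.sum_congr rfl fun k _ => ?_
    by_cases h : c k = i <;> simp [h]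
  simp only [dotProduct]
  rw [Fintype.sum_prod_type]
  simp only [e2]
  exact Finset.single_le_sum (f := fun i => ∑ x, (flat (fun k => (c k, ρ k))
    (fun k => (c k, γ k)) a).mulVec (fun p => if p.1 = _ then v p.2 else 0) (i, x) * _)
    (fun i _ => Finset.sum_nonneg fun _ _ => mul_self_nonneg _) (Finset.mem_univ i)

theorem norm_rowStack_smul_le (A : ι → Matrix I J ℝ) (y : ι → ℝ) {s : ℝ} (hs : 0 ≤ s)
    (hy : ∀ i, |y i| ≤ s) : ‖rowStack fun i => y i • A i‖ ≤ s * ‖rowStack A‖ := by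
  refine opNorm_le_of_mulVec _ (by positivity) fun v => ?_
  rw [mul_pow, mul_assoc]
  refine le_trans ?_ (mul_le_mul_of_nonneg_left (mulVec_dotProduct_le (rowStack A) v)
    (sq_nonneg s))
  rw [rowStack_mulVec, rowStack_mulVec, Finset.mul_sum]
  refine Finset.sum_le_sum fun i _ => ?_
  rw [Matrix.smul_mulVec, smul_dotProduct, dotProduct_smul, smul_eq_mul, smul_eq_mul,
    ← mul_assoc, ← pow_two]
  refine mul_le_mul_of_nonneg_right (sq_le_sq' (by linarith [neg_abs_le (y i), hy i])
    ((le_abs_self _).trans (hy i))) ?_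
  rw [← norm_toLp_sq]; positivity

/-- Stacking the weighted Gram matrices `y i ^ 2 • (A i)ᵀ A i`. -/
theorem norm_rowStack_gram_le (A : ι → Matrix I J ℝ) (y : ι → ℝ) {s b : ℝ} (hs : 0 ≤ s)
    (hb : 0 ≤ b) (hy : ∀ i, |y i| ≤ s) (hA : ∀ i, ‖A i‖ ≤ b) :
    ‖rowStack fun i => y i ^ 2 • ((A i).transpose * A i)‖ ≤
      s * b * ‖rowStack fun i => y i • A i‖ := by
  refine opNorm_le_of_mulVec _ (by positivity) fun v => ?_
  rw [mul_pow, mul_assoc]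
  refine le_trans ?_ (mul_le_mul_of_nonneg_left (mulVec_dotProduct_le
    (rowStack fun i => y i • A i) v) (sq_nonneg (s * b)))
  rw [rowStack_mulVec, rowStack_mulVec, Finset.mul_sum]
  refine Finset.sum_le_sum fun i _ => ?_
  simp only [Matrix.smul_mulVec, smul_dotProduct, dotProduct_smul, smul_eq_mul,
    ← Matrix.mulVec_mulVec]
  set w := (A i).mulVec v
  have h1 := mulVec_dotProduct_le (A i).transpose w
  rw [opNorm_transpose] at h1
  have hw : 0 ≤ w ⬝ᵥ w := by rw [← norm_toLp_sq]; positivity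
  have h2 : ‖A i‖ ^ 2 ≤ b ^ 2 := by have := hA i; gcongr
  have h3 : y i ^ 2 ≤ s ^ 2 := sq_le_sq' (by linarith [neg_abs_le (y i), hy i])
    ((le_abs_self _).trans (hy i))
  calc _ ≤ y i ^ 2 * (s ^ 2 * (b ^ 2 * (w ⬝ᵥ w))) := by
        refine mul_le_mul_of_nonneg_left ?_ (sq_nonneg _)
        refine mul_le_mul h3 (h1.trans ?_) ?_ (sq_nonneg s)
        · exact mul_le_mul_of_nonneg_right h2 hw
        · rw [← norm_toLp_sq]; positivity
    _ = _ := by ring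

end Flat

/-! ### Symmetrization of centered sums -/

section Symmetrization

theorem lintegral_pi_update {δ : Type*} [Fintype δ] [DecidableEq δ] {X : δ → Type*}
    [∀ i, MeasurableSpace (X i)] (μ : ∀ i, Measure (X i)) [∀ i, IsProbabilityMeasure (μ i)]
    (t : δ) {f : (∀ i, X i) → ℝ≥0∞} (hf : Measurable f) :
    ∫⁻ x, f x ∂Measure.pi μ = ∫⁻ x, ∫⁻ y, f (Function.update x t y) ∂μ t ∂Measure.pi μ := by
  have h : (fun x => ∫⁻ y, f (Function.update x t y) ∂μ t) = lmarginal μ {t} f := by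
    rw [lmarginal_singleton]
  rw [h]
  refine lintegral_eq_of_lmarginal_eq {t} hf (hf.lmarginal μ) ?_
  conv_rhs => rw [lmarginal_singleton]
  funext x
  simp [lmarginal_update_of_mem]

variable {ι : Type*} [Fintype ι] [DecidableEq ι]
  {E : Type*} [NormedAddCommGroup E] [NormedSpace ℝ E] [CompleteSpace E]
  (ν : Measure ℝ) [IsProbabilityMeasure ν]

theorem measurable_enorm_sum (A : ι → E) {g : ℝ → ℝ} (hg : Measurable g) (s : Finset ι) :
    Measurable fun x : ι → ℝ => ‖∑ i ∈ s, g (x i) • A i‖ₑ := by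
  have h1 : Continuous fun c : ι → ℝ => ‖∑ i ∈ s, c i • A i‖ₑ := by fun_prop
  exact h1.measurable.comp (measurable_pi_lambda _ fun i => hg.comp (measurable_pi_apply i))

/-- Conditional Jensen: integrating the coordinate `j` inside the norm removes the new centered
term. -/
theorem lintegral_enorm_sum_insert_le (A : ι → E) {g : ℝ → ℝ} (hg : Measurable g)
    (hi : Integrable g ν) (h0 : ∫ y, g y ∂ν = 0) (s : Finset ι) {j : ι} (hj : j ∉ s) :
    ∫⁻ x, ‖∑ i ∈ s, g (x i) • A i‖ₑ ∂Measure.pi (fun _ => ν) ≤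
      ∫⁻ x, ‖∑ i ∈ insert j s, g (x i) • A i‖ₑ ∂Measure.pi (fun _ => ν) := by
  rw [lintegral_pi_update (fun _ : ι => ν) j (measurable_enorm_sum A hg (insert j s))]
  refine lintegral_mono fun x => ?_
  have e : ∀ y, ∑ i ∈ insert j s, g (Function.update x j y i) • A i =
      g y • A j + ∑ i ∈ s, g (x i) • A i := by
    intro y
    rw [Finset.sum_insert hj, Function.update_self]
    congr 1
    refine Finset.sum_congr rfl fun i hi => ?_
    rw [Function.update_of_ne (by rintro rfl; exact hj hi)]
  simp only [e]
  refine le_trans (le_of_eq ?_) (enorm_integral_le_lintegral_enorm _)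
  rw [integral_add (hi.smul_const _) (integrable_const _), integral_smul_const, h0]
  simp

theorem lintegral_enorm_sum_le (A : ι → E) {g : ℝ → ℝ} (hg : Measurable g)
    (hi : Integrable g ν) (h0 : ∫ y, g y ∂ν = 0) (s : Finset ι) :
    ∫⁻ x, ‖∑ i ∈ s, g (x i) • A i‖ₑ ∂Measure.pi (fun _ => ν) ≤
      ∫⁻ x, ‖∑ i, g (x i) • A i‖ₑ ∂Measure.pi (fun _ => ν) := by
  have key : ∀ t : Finset ι, Disjoint s t →
      ∫⁻ x, ‖∑ i ∈ s, g (x i) • A i‖ₑ ∂Measure.pi (fun _ => ν) ≤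
      ∫⁻ x, ‖∑ i ∈ t ∪ s, g (x i) • A i‖ₑ ∂Measure.pi (fun _ => ν) := by
    intro t
    induction t using Finset.induction_on with
    | empty => simp
    | insert j t hj ih =>
      intro hd
      rw [Finset.disjoint_insert_right] at hd
      rw [Finset.insert_union]
      refine (ih hd.2).trans (lintegral_enorm_sum_insert_le ν A hg hi h0 _ ?_)
      simp [hj, hd.1]
  have h := key sᶜ disjoint_compl_right
  rwa [Finset.union_comm, Finset.union_compl] at h

/-- The law need not be symmetric. The signed sum is a difference of two partial sums, and each is
dominated in mean by the full sum. -/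
theorem lintegral_signSum_le (A : ι → E) {g : ℝ → ℝ} (hg : Measurable g)
    (hi : Integrable g ν) (h0 : ∫ y, g y ∂ν = 0) (ε : ι → ℤˣ) :
    ∫⁻ x, ‖signSum (fun i => g (x i) • A i) ε‖ₑ ∂Measure.pi (fun _ => ν) ≤
      2 * ∫⁻ x, ‖∑ i, g (x i) • A i‖ₑ ∂Measure.pi (fun _ => ν) := by
  have e : ∀ x : ι → ℝ, signSum (fun i => g (x i) • A i) ε =
      ∑ i with ε i = 1, g (x i) • A i - ∑ i with ¬ ε i = 1, g (x i) • A i := by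
    intro x
    rw [signSum, ← Finset.sum_filter_add_sum_filter_not _ (fun i => ε i = 1), sub_eq_add_neg,
      ← Finset.sum_neg_distrib]
    congr 1
    · refine Finset.sum_congr rfl fun i hi => ?_
      simp [(Finset.mem_filter.mp hi).2]
    · refine Finset.sum_congr rfl fun i hi => ?_
      have := (Int.units_eq_one_or (ε i)).resolve_left (Finset.mem_filter.mp hi).2
      simp [this]
  calc _ ≤ ∫⁻ x, (‖∑ i with ε i = 1, g (x i) • A i‖ₑ + ‖∑ i with ¬ ε i = 1, g (x i) • A i‖ₑ)
          ∂Measure.pi (fun _ => ν) := by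
        refine lintegral_mono fun x => ?_
        rw [e]
        exact enorm_sub_le
    _ = _ := lintegral_add_left (measurable_enorm_sum A hg _) _
    _ ≤ _ := by
        rw [two_mul]
        exact add_le_add (lintegral_enorm_sum_le ν A hg hi h0 _)
          (lintegral_enorm_sum_le ν A hg hi h0 _)

theorem le_lintegral_signSum (A : ι → E) {g : ℝ → ℝ} (hg : Measurable g)
    (hi : Integrable g ν) (h0 : ∫ y, g y ∂ν = 0) (ε : ι → ℤˣ) :
    ∫⁻ x, ‖∑ i, g (x i) • A i‖ₑ ∂Measure.pi (fun _ => ν) ≤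
      2 * ∫⁻ x, ‖signSum (fun i => g (x i) • A i) ε‖ₑ ∂Measure.pi (fun _ => ν) := by
  have h := lintegral_signSum_le ν (fun i => sgn (ε i) • A i) hg hi h0 ε
  have e1 : ∀ x : ι → ℝ, signSum (fun i => g (x i) • sgn (ε i) • A i) ε =
      ∑ i, g (x i) • A i := by
    intro x
    refine Finset.sum_congr rfl fun i _ => ?_
    simp only
    rw [smul_comm (g (x i)), smul_smul, sgn_mul_self, one_smul]
  have e2 : ∀ x : ι → ℝ, ∑ i, g (x i) • sgn (ε i) • A i =
      signSum (fun i => g (x i) • A i) ε := fun x =>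
    Finset.sum_congr rfl fun i _ => smul_comm _ _ _
  simpa only [e1, e2] using h

theorem lintegral_ofReal_signAvg (A : ι → E) {g : ℝ → ℝ} (hg : Measurable g) :
    ∫⁻ x, ENNReal.ofReal (signAvg fun ε => ‖signSum (fun i => g (x i) • A i) ε‖)
        ∂Measure.pi (fun _ => ν) =
      (Fintype.card (ι → ℤˣ) : ℝ≥0∞)⁻¹ *
        ∑ ε, ∫⁻ x, ‖signSum (fun i => g (x i) • A i) ε‖ₑ ∂Measure.pi (fun _ => ν) := by
  have hm : ∀ ε : ι → ℤˣ, Measurable fun x : ι → ℝ => ‖signSum (fun i => g (x i) • A i) ε‖ₑ := by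
    intro ε
    have e2 : ∀ x : ι → ℝ, signSum (fun i => g (x i) • A i) ε =
      ∑ i, g (x i) • sgn (ε i) • A i := fun x =>
        Finset.sum_congr rfl fun i _ => smul_comm _ _ _
    simp only [e2]
    exact measurable_enorm_sum _ hg _
  rw [← lintegral_finsetSum _ fun ε _ => hm ε, ← lintegral_const_mul _
    (Finset.measurable_fun_sum _ fun ε _ => hm ε)]
  refine lintegral_congr fun x => ?_
  rw [signAvg, ENNReal.ofReal_mul (by positivity), ENNReal.ofReal_inv_of_pos
    (by exact_mod_cast Fintype.card_pos), ENNReal.ofReal_natCast,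
    ENNReal.ofReal_sum_of_nonneg fun _ _ => norm_nonneg _]
  simp only [ofReal_norm]

theorem inv_card_mul_sum_const (c : ℝ≥0∞) :
    (Fintype.card (ι → ℤˣ) : ℝ≥0∞)⁻¹ * ∑ _ε : ι → ℤˣ, c = c := by
  rw [Finset.sum_const, Finset.card_univ, nsmul_eq_mul, ← mul_assoc, ENNReal.inv_mul_cancel,
    one_mul]
  · exact_mod_cast Fintype.card_ne_zero
  · exact ENNReal.natCast_ne_top _

theorem lintegral_le_signAvg (A : ι → E) {g : ℝ → ℝ} (hg : Measurable g)
    (hi : Integrable g ν) (h0 : ∫ y, g y ∂ν = 0) :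
    ∫⁻ x, ‖∑ i, g (x i) • A i‖ₑ ∂Measure.pi (fun _ => ν) ≤
      2 * ∫⁻ x, ENNReal.ofReal (signAvg fun ε => ‖signSum (fun i => g (x i) • A i) ε‖)
        ∂Measure.pi (fun _ => ν) := by
  rw [lintegral_ofReal_signAvg ν A hg, mul_left_comm, Finset.mul_sum,
    ← inv_card_mul_sum_const (ι := ι) (∫⁻ x, ‖∑ i, g (x i) • A i‖ₑ ∂Measure.pi (fun _ => ν))]
  gcongr with ε
  exact le_lintegral_signSum ν A hg hi h0 ε

theorem signAvg_le_lintegral (A : ι → E) {g : ℝ → ℝ} (hg : Measurable g)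
    (hi : Integrable g ν) (h0 : ∫ y, g y ∂ν = 0) :
    ∫⁻ x, ENNReal.ofReal (signAvg fun ε => ‖signSum (fun i => g (x i) • A i) ε‖)
        ∂Measure.pi (fun _ => ν) ≤
      2 * ∫⁻ x, ‖∑ i, g (x i) • A i‖ₑ ∂Measure.pi (fun _ => ν) := by
  rw [lintegral_ofReal_signAvg ν A hg,
    ← inv_card_mul_sum_const (ι := ι) (2 * ∫⁻ x, ‖∑ i, g (x i) • A i‖ₑ ∂Measure.pi (fun _ => ν))]
  gcongr with ε
  exact lintegral_signSum_le ν A hg hi h0 ε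

end Symmetrization

/-! ### Khintchine for independent centered coefficients -/

section Block

variable {ι I J : Type*} [Fintype ι] [DecidableEq ι] [Fintype I] [DecidableEq I]
  [Fintype J] [DecidableEq J] (ν : Measure ℝ) [IsProbabilityMeasure ν]

instance : CompleteSpace (Matrix I J ℝ) := FiniteDimensional.complete ℝ _

theorem measurable_enorm_rowStack (A : ι → Matrix I J ℝ) :
    Measurable fun x : ι → ℝ => ‖rowStack fun i => x i • A i‖ₑ := by
  have : Continuous fun x : ι → ℝ => rowStack fun i => x i • A i := by
    refine continuous_matrix fun i j => ?_
    simp only [rowStack, Matrix.of_apply, Matrix.smul_apply]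
    fun_prop
  exact this.enorm.measurable

/-- Upper Khintchine bound for sums with independent centered coefficients. -/
theorem lintegral_enorm_sum_le_stack (A : ι → Matrix I J ℝ) (hi : Integrable (fun y => y) ν)
    (h0 : ∫ y, y ∂ν = 0) {l : ℝ} (hl : 1 ≤ l)
    (hn : (Fintype.card I + Fintype.card J : ℝ) ≤ Real.exp l) :
    ∫⁻ x, ‖∑ i, x i • A i‖ₑ ∂Measure.pi (fun _ => ν) ≤
      ENNReal.ofReal (16 * √l) *
        (∫⁻ x, ‖rowStack fun i => x i • A i‖ₑ ∂Measure.pi (fun _ => ν) +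
          ∫⁻ x, ‖colStack fun i => x i • A i‖ₑ ∂Measure.pi (fun _ => ν)) := by
  refine (lintegral_le_signAvg ν A measurable_id hi h0).trans ?_
  rw [← lintegral_add_left (measurable_enorm_rowStack A), ← lintegral_const_mul',
    ← lintegral_const_mul' _ _ ENNReal.ofReal_ne_top]
  · refine lintegral_mono fun x => ?_
    have h := signAvg_opNorm_le (fun i => x i • A i) hl hn
    calc _ ≤ 2 * ENNReal.ofReal (8 * √l * (‖rowStack fun i => x i • A i‖ +
          ‖colStack fun i => x i • A i‖)) := by gcongr; exact h
      _ = _ := by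
        rw [ENNReal.ofReal_mul (by positivity), ENNReal.ofReal_add (norm_nonneg _)
          (norm_nonneg _), ofReal_norm, ofReal_norm, ← mul_assoc,
          show (16 : ℝ) * √l = 2 * (8 * √l) by ring, ENNReal.ofReal_mul zero_le_two,
          ENNReal.ofReal_ofNat]
  · simp

theorem lintegral_enorm_rowStack_le (A : ι → Matrix I J ℝ) (hi : Integrable (fun y => y) ν)
    (h0 : ∫ y, y ∂ν = 0) :
    ∫⁻ x, ‖rowStack fun i => x i • A i‖ₑ ∂Measure.pi (fun _ => ν) ≤
      4 * ∫⁻ x, ‖∑ i, x i • A i‖ₑ ∂Measure.pi (fun _ => ν) := by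
  have h := signAvg_le_lintegral ν A measurable_id hi h0
  calc _ ≤ ∫⁻ x, 2 * ENNReal.ofReal (signAvg fun ε => ‖signSum (fun i => x i • A i) ε‖)
        ∂Measure.pi (fun _ => ν) := by
        refine lintegral_mono fun x => ?_
        rw [← ofReal_norm, ← ENNReal.ofReal_ofNat, ← ENNReal.ofReal_mul zero_le_two]
        exact ENNReal.ofReal_le_ofReal (norm_rowStack_le_signAvg _)
    _ ≤ _ := by
        rw [lintegral_const_mul' _ _ (by simp), show (4 : ℝ≥0∞) = 2 * 2 by norm_num, mul_assoc]
        gcongr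
        exact h

end Block

theorem integral_mul_le_sqrt {Ω : Type*} [MeasurableSpace Ω] (μ : Measure Ω) {f g : Ω → ℝ}
    (hf : MemLp f 2 μ) (hg : MemLp g 2 μ) (hf0 : ∀ x, 0 ≤ f x) (hg0 : ∀ x, 0 ≤ g x) :
    ∫ x, f x * g x ∂μ ≤ √(∫ x, f x ^ 2 ∂μ) * √(∫ x, g x ^ 2 ∂μ) := by
  have h := integral_mul_le_Lp_mul_Lq_of_nonneg (μ := μ) Real.HolderConjugate.two_two
    (Filter.Eventually.of_forall hf0) (Filter.Eventually.of_forall hg0)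
    (by simpa using hf) (by simpa using hg)
  simpa [Real.sqrt_eq_rpow] using h

/-! ### Removing the weights from a row stack -/

section Deviation

variable {ι I J : Type*} [Fintype ι] [DecidableEq ι] [Fintype I] [DecidableEq I]
  [Fintype J] [DecidableEq J] (ν : Measure ℝ) [IsProbabilityMeasure ν]

theorem continuous_norm_rowStack (A : ι → Matrix I J ℝ) :
    Continuous fun x : ι → ℝ => ‖rowStack fun i => x i • A i‖ := by
  have : Continuous fun x : ι → ℝ => rowStack fun i => x i • A i := by
    refine continuous_matrix fun i j => ?_
    simp only [rowStack, Matrix.of_apply, Matrix.smul_apply]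
    fun_prop
  exact this.norm

theorem norm_sum_sq_smul_gram (A : ι → Matrix I J ℝ) (x : ι → ℝ) :
    ‖∑ i, x i ^ 2 • ((A i).transpose * A i)‖ = ‖rowStack fun i => x i • A i‖ ^ 2 := by
  rw [← norm_sum_gram]
  congr 1
  refine Finset.sum_congr rfl fun i _ => ?_
  rw [Matrix.transpose_smul, Matrix.smul_mul, Matrix.mul_smul, smul_smul, pow_two]

theorem signAvg_gram_le (A : ι → Matrix I J ℝ) (x : ι → ℝ) {l b : ℝ} (hl : 1 ≤ l) (hb : 0 ≤ b)
    (hn : (2 * Fintype.card J : ℝ) ≤ Real.exp l) (hA : ∀ i, ‖A i‖ ≤ b) :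
    signAvg (fun ε => ‖signSum (fun i => (x i ^ 2 - 1) • ((A i).transpose * A i)) ε‖) ≤
      16 * √l * b * (‖x‖ * ‖rowStack fun i => x i • A i‖ + ‖rowStack A‖) := by
  have kh : ∀ y : ι → ℝ, signAvg (fun ε =>
      ‖signSum (fun i => y i ^ 2 • ((A i).transpose * A i)) ε‖) ≤
      16 * √l * b * (‖y‖ * ‖rowStack fun i => y i • A i‖) := by
    intro y
    have h1 := signAvg_opNorm_le (fun i => y i ^ 2 • ((A i).transpose * A i)) hl
      (by rw [← two_mul]; exact hn)
    have h2 := norm_rowStack_transpose fun i => y i ^ 2 • ((A i).transpose * A i)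
    simp only [Matrix.transpose_smul, Matrix.transpose_mul, Matrix.transpose_transpose] at h2
    -- Gram matrices are symmetric, so the column stack has the norm of the row stack.
    rw [← h2] at h1
    have h3 := norm_rowStack_gram_le A y (norm_nonneg y) hb (fun i => norm_le_pi_norm y i) hA
    calc _ ≤ _ := h1
      _ ≤ 8 * √l * (‖y‖ * b * ‖rowStack fun i => y i • A i‖ +
        ‖y‖ * b * ‖rowStack fun i => y i • A i‖) := by gcongr
      _ = _ := by ring
  have h1 := kh x
  have h2 := kh fun _ => 1
  simp only [one_pow, one_smul] at h2
  have h3 : ‖(fun _ => 1 : ι → ℝ)‖ ≤ 1 := pi_norm_le_iff_of_nonneg zero_le_one |>.mpr (by simp)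
  calc _ ≤ signAvg (fun ε => ‖signSum (fun i => x i ^ 2 • ((A i).transpose * A i)) ε‖ +
        ‖signSum (fun i => (A i).transpose * A i) ε‖) := by
        refine signAvg_mono fun ε => ?_
        have : signSum (fun i => (x i ^ 2 - 1) • ((A i).transpose * A i)) ε =
            signSum (fun i => x i ^ 2 • ((A i).transpose * A i)) ε -
            signSum (fun i => (A i).transpose * A i) ε := by
          simp [signSum, sub_smul, smul_sub]
        rw [this]; exact norm_sub_le _ _
    _ ≤ _ := by
        rw [signAvg_add, mul_add]
        refine add_le_add h1 (h2.trans ?_)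
        gcongr
        exact mul_le_of_le_one_left (norm_nonneg _) h3

/-- Here `u` is the unweighted norm, `τ` the `L²` norm of the weighted one, `w` the mean Gram
deviation and `e` the mean absolute deviation. The first two inequalities give `τ ≤ u + β`. If `β ≤
u`, then `u e ≤ w ≤ 3 β u`; otherwise `u` and `τ` are themselves of order `β`. -/
theorem le_three_mul_of_moments {u w τ β e : ℝ} (hu : 0 ≤ u) (hτ : 0 ≤ τ) (hβ : 0 ≤ β)
    (h1 : τ ^ 2 ≤ u ^ 2 + w) (h2 : w ≤ β * (τ + u)) (h3 : u * e ≤ w) (h4 : e ≤ τ + u) :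
    e ≤ 3 * β := by
  rcases le_or_gt β u with h | h
  · have hτu : τ ≤ 2 * u := by nlinarith
    rcases hu.eq_or_lt with h0 | h0
    · nlinarith
    · have : u * e ≤ u * (3 * β) := by nlinarith
      exact le_of_mul_le_mul_left this h0
  · have : τ ≤ 2 * β := by nlinarith
    linarith

variable {ν}

/-- Unit second moment makes `y² - 1` centered, so symmetrization applies with only two moments of
`ν`. Integrability of the Gram deviation comes from the bound itself. -/
theorem integral_norm_sum_sub_one_le (A : ι → Matrix I J ℝ) (hν : MemLp (fun y => y) 2 ν)
    (h1 : ∫ y, y ^ 2 ∂ν = 1) {l b : ℝ} (hl : 1 ≤ l) (hb : 0 ≤ b)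
    (hn : (2 * Fintype.card J : ℝ) ≤ Real.exp l) (hA : ∀ i, ‖A i‖ ≤ b)
    (hxZ : Integrable (fun x : ι → ℝ => ‖x‖ * ‖rowStack fun i => x i • A i‖)
      (Measure.pi fun _ => ν)) :
    Integrable (fun x : ι → ℝ => ‖∑ i, (x i ^ 2 - 1) • ((A i).transpose * A i)‖)
      (Measure.pi fun _ => ν) ∧
    ∫ x : ι → ℝ, ‖∑ i, (x i ^ 2 - 1) • ((A i).transpose * A i)‖ ∂Measure.pi (fun _ => ν) ≤
      32 * √l * b * (∫ x : ι → ℝ, ‖x‖ * ‖rowStack fun i => x i • A i‖ ∂Measure.pi (fun _ => ν) +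
        ‖rowStack A‖) := by
  have hgi : Integrable (fun y : ℝ => y ^ 2 - 1) ν := hν.integrable_sq.sub (integrable_const _)
  have hg0 : ∫ y : ℝ, (y ^ 2 - 1) ∂ν = 0 := by
    rw [integral_sub hν.integrable_sq (integrable_const _), h1]; simp
  have hsym := lintegral_le_signAvg ν (fun i => (A i).transpose * A i)
    (g := fun y => y ^ 2 - 1) (by fun_prop) hgi hg0
  have hWc : Continuous fun x : ι → ℝ =>
      ‖∑ i, (x i ^ 2 - 1) • ((A i).transpose * A i)‖ := by
    have : Continuous fun c : ι → ℝ => ‖∑ i, c i • ((A i).transpose * A i)‖ := by fun_prop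
    exact this.comp (by fun_prop : Continuous fun x : ι → ℝ => fun i => x i ^ 2 - 1)
  have hB : Integrable (fun x : ι → ℝ =>
      32 * √l * b * (‖x‖ * ‖rowStack fun i => x i • A i‖ + ‖rowStack A‖))
      (Measure.pi fun _ => ν) := (hxZ.add (integrable_const _)).const_mul _
  have hB0 : ∀ x : ι → ℝ,
      0 ≤ 32 * √l * b * (‖x‖ * ‖rowStack fun i => x i • A i‖ + ‖rowStack A‖) :=
    fun x => by positivity
  have hWle : ∫⁻ x : ι → ℝ, ‖∑ i, (x i ^ 2 - 1) • ((A i).transpose * A i)‖ₑ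
      ∂Measure.pi (fun _ => ν) ≤ ENNReal.ofReal (∫ x : ι → ℝ,
      32 * √l * b * (‖x‖ * ‖rowStack fun i => x i • A i‖ + ‖rowStack A‖)
      ∂Measure.pi (fun _ => ν)) := by
    rw [ofReal_integral_eq_lintegral_ofReal hB (Filter.Eventually.of_forall hB0)]
    refine hsym.trans ?_
    rw [← lintegral_const_mul' _ _ (by simp)]
    refine lintegral_mono fun x => ?_
    rw [← ENNReal.ofReal_ofNat, ← ENNReal.ofReal_mul zero_le_two]
    refine ENNReal.ofReal_le_ofReal ?_
    have := signAvg_gram_le A x hl hb hn hA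
    linarith
  have hWi : Integrable (fun x : ι → ℝ => ‖∑ i, (x i ^ 2 - 1) • ((A i).transpose * A i)‖)
      (Measure.pi fun _ => ν) := by
    refine ⟨hWc.aestronglyMeasurable, ?_⟩
    simpa only [HasFiniteIntegral, enorm_norm] using hWle.trans_lt ENNReal.ofReal_lt_top
  refine ⟨hWi, ?_⟩
  have e : 32 * √l * b * (∫ x : ι → ℝ, ‖x‖ * ‖rowStack fun i => x i • A i‖
      ∂Measure.pi (fun _ => ν) + ‖rowStack A‖) = ∫ x : ι → ℝ,
      32 * √l * b * (‖x‖ * ‖rowStack fun i => x i • A i‖ + ‖rowStack A‖)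
      ∂Measure.pi (fun _ => ν) := by
    rw [integral_const_mul, integral_add hxZ (integrable_const _), integral_const,
      probReal_univ, one_smul]
  rw [e, ← ENNReal.ofReal_le_ofReal_iff (integral_nonneg hB0),
    ofReal_integral_eq_lintegral_ofReal hWi (Filter.Eventually.of_forall fun x => norm_nonneg _)]
  simpa only [ofReal_norm] using hWle

theorem abs_sq_rowStack_sub_le (A : ι → Matrix I J ℝ) (x : ι → ℝ) :
    |‖rowStack fun i => x i • A i‖ ^ 2 - ‖rowStack A‖ ^ 2| ≤
      ‖∑ i, (x i ^ 2 - 1) • ((A i).transpose * A i)‖ := by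
  rw [← norm_sum_sq_smul_gram A x, ← norm_sum_gram A]
  simp only [sub_smul, one_smul, Finset.sum_sub_distrib]
  exact abs_norm_sub_norm_le _ _

theorem integral_abs_rowStack_sub_le (A : ι → Matrix I J ℝ) (hν : MemLp (fun y => y) 2 ν)
    (h1 : ∫ y, y ^ 2 ∂ν = 1) {l b S : ℝ} (hl : 1 ≤ l) (hb : 0 ≤ b) (hS : 1 ≤ S)
    (hn : (2 * Fintype.card J : ℝ) ≤ Real.exp l) (hA : ∀ i, ‖A i‖ ≤ b)
    (hx : MemLp (fun x : ι → ℝ => x) 2 (Measure.pi fun _ => ν))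
    (hxS : ∫ x : ι → ℝ, ‖x‖ ^ 2 ∂Measure.pi (fun _ => ν) ≤ S ^ 2) :
    Integrable (fun x : ι → ℝ => ‖rowStack fun i => x i • A i‖) (Measure.pi fun _ => ν) ∧
    ∫ x : ι → ℝ, |‖rowStack fun i => x i • A i‖ - ‖rowStack A‖| ∂Measure.pi (fun _ => ν) ≤
      3 * (32 * √l * b * S) := by
  set μ := Measure.pi fun _ : ι => ν
  set Z : (ι → ℝ) → ℝ := fun x => ‖rowStack fun i => x i • A i‖ with hZ
  set u := ‖rowStack A‖ with hu
  have hZ0 : ∀ x, 0 ≤ Z x := fun x => norm_nonneg _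
  have hxn : MemLp (fun x : ι → ℝ => ‖x‖) 2 μ := hx.norm
  have hZle : ∀ x : ι → ℝ, Z x ≤ ‖x‖ * u := fun x =>
    norm_rowStack_smul_le A x (norm_nonneg x) fun i => norm_le_pi_norm x i
  have hZ2 : MemLp Z 2 μ := by
    refine hx.of_le_mul (c := u) (continuous_norm_rowStack A).aestronglyMeasurable
      (Filter.Eventually.of_forall fun x => ?_)
    rw [Real.norm_of_nonneg (hZ0 x), mul_comm]
    exact hZle x
  have hZi : Integrable Z μ := hZ2.integrable one_le_two
  have hZsq : Integrable (fun x => Z x ^ 2) μ := hZ2.integrable_sq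
  refine ⟨hZi, ?_⟩
  change ∫ x, |Z x - u| ∂μ ≤ _
  have hxZ : Integrable (fun x => ‖x‖ * Z x) μ := hxn.integrable_mul hZ2
  obtain ⟨hWi, hWr⟩ := integral_norm_sum_sub_one_le A hν h1 hl hb hn hA hxZ
  have hZW := abs_sq_rowStack_sub_le A
  set W : (ι → ℝ) → ℝ := fun x => ‖∑ i, (x i ^ 2 - 1) • ((A i).transpose * A i)‖ with hW
  change ∀ x, |Z x ^ 2 - u ^ 2| ≤ W x at hZW
  change Integrable W μ at hWi
  change ∫ x, W x ∂μ ≤ 32 * √l * b * (∫ x, ‖x‖ * Z x ∂μ + u) at hWr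
  clear_value W Z
  set τ := √(∫ x, Z x ^ 2 ∂μ) with hτ
  have hτ2 : τ ^ 2 = ∫ x, Z x ^ 2 ∂μ := Real.sq_sqrt (integral_nonneg fun x => sq_nonneg _)
  have hτ0 : 0 ≤ τ := Real.sqrt_nonneg _
  -- Cauchy–Schwarz turns the bound on the Gram deviation into one in terms of `τ`, which closes the
  -- self-referential inequality.
  have hCS : ∫ x, ‖x‖ * Z x ∂μ ≤ S * τ := by
    refine (integral_mul_le_sqrt μ hxn hZ2 (fun x => norm_nonneg x) hZ0).trans ?_
    gcongr
    exact Real.sqrt_le_iff.mpr ⟨by linarith, hxS⟩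
  have hZτ : ∫ x, Z x ∂μ ≤ τ := by
    have := integral_mul_le_sqrt μ (memLp_const (1 : ℝ)) hZ2 (fun _ => zero_le_one) hZ0
    simpa using this
  have hdi : Integrable (fun x => |Z x - u|) μ := (hZi.sub (integrable_const u)).abs
  refine le_three_mul_of_moments (u := u) (w := ∫ x, W x ∂μ) (τ := τ) (norm_nonneg _) hτ0
    (by positivity) ?_ ?_ ?_ ?_
  · rw [hτ2]
    have : ∫ x, Z x ^ 2 ∂μ ≤ ∫ x, (u ^ 2 + W x) ∂μ :=
      integral_mono hZsq ((integrable_const _).add hWi) fun x => by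
        have := le_of_abs_le (hZW x); linarith
    rwa [integral_add (integrable_const _) hWi, integral_const, probReal_univ, one_smul] at this
  · refine hWr.trans ?_
    rw [mul_assoc _ S]
    refine mul_le_mul_of_nonneg_left ?_ (by positivity)
    nlinarith [norm_nonneg (rowStack A)]
  · rw [← integral_const_mul]
    refine integral_mono (hdi.const_mul _) hWi fun x => ?_
    refine le_trans ?_ (hZW x)
    rw [sq_sub_sq, abs_mul, abs_of_nonneg (add_nonneg (hZ0 x) (norm_nonneg _))]
    refine mul_le_mul_of_nonneg_right ?_ (abs_nonneg _)
    linarith [hZ0 x]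
  · have : ∫ x, |Z x - u| ∂μ ≤ ∫ x, (Z x + u) ∂μ :=
      integral_mono hdi (hZi.add (integrable_const _)) fun x => by
        have : 0 ≤ u := norm_nonneg _
        exact abs_le.mpr ⟨by linarith [hZ0 x], by linarith⟩
    rw [integral_add hZi (integrable_const _), integral_const, probReal_univ, one_smul] at this
    linarith

theorem lintegral_enorm_rowStack_deviation (A : ι → Matrix I J ℝ) (hν : MemLp (fun y => y) 2 ν)
    (h1 : ∫ y, y ^ 2 ∂ν = 1) {l b S : ℝ} (hl : 1 ≤ l) (hb : 0 ≤ b) (hS : 1 ≤ S)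
    (hn : (2 * Fintype.card J : ℝ) ≤ Real.exp l) (hA : ∀ i, ‖A i‖ ≤ b)
    (hxS : eLpNorm (fun x : ι → ℝ => x) 2 (Measure.pi fun _ => ν) ≤ ENNReal.ofReal S) :
    ∫⁻ x, ‖rowStack fun i => x i • A i‖ₑ ∂Measure.pi (fun _ => ν) ≤
        ‖rowStack A‖ₑ + ENNReal.ofReal (96 * √l * b * S) ∧
    ‖rowStack A‖ₑ ≤ ∫⁻ x, ‖rowStack fun i => x i • A i‖ₑ ∂Measure.pi (fun _ => ν) +
        ENNReal.ofReal (96 * √l * b * S) := by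
  have hx : MemLp (fun x : ι → ℝ => x) 2 (Measure.pi fun _ => ν) :=
    ⟨continuous_id.aestronglyMeasurable, hxS.trans_lt ENNReal.ofReal_lt_top⟩
  have hxS' : ∫ x : ι → ℝ, ‖x‖ ^ 2 ∂Measure.pi (fun _ => ν) ≤ S ^ 2 := by
    have e := hx.eLpNorm_eq_integral_rpow_norm two_ne_zero ENNReal.ofNat_ne_top
    rw [e, ENNReal.ofReal_le_ofReal_iff (by linarith)] at hxS
    have h0 : 0 ≤ ∫ x : ι → ℝ, ‖x‖ ^ 2 ∂Measure.pi (fun _ => ν) :=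
      integral_nonneg fun x => sq_nonneg _
    have h2 : √(∫ x : ι → ℝ, ‖x‖ ^ 2 ∂Measure.pi (fun _ => ν)) ≤ S := by
      rw [Real.sqrt_eq_rpow]
      simpa using hxS
    rw [← Real.sq_sqrt h0]
    gcongr
  obtain ⟨hi, hd⟩ := integral_abs_rowStack_sub_le A hν h1 hl hb hS hn hA hx hxS'
  set Z : (ι → ℝ) → ℝ := fun x => ‖rowStack fun i => x i • A i‖ with hZ
  have e : ∫⁻ x, ‖rowStack fun i => x i • A i‖ₑ ∂Measure.pi (fun _ => ν) =
      ENNReal.ofReal (∫ x, Z x ∂Measure.pi (fun _ => ν)) := by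
    rw [ofReal_integral_eq_lintegral_ofReal hi (Filter.Eventually.of_forall fun x =>
      norm_nonneg _)]
    simp only [hZ, ofReal_norm]
  have hdi : |∫ x, Z x ∂Measure.pi (fun _ => ν) - ‖rowStack A‖| ≤ 96 * √l * b * S := by
    have := abs_integral_le_integral_abs (f := fun x => Z x - ‖rowStack A‖)
      (μ := Measure.pi (fun _ => ν))
    rw [integral_sub hi (integrable_const _), integral_const, probReal_univ, one_smul] at this
    refine this.trans (hd.trans (le_of_eq (by ring)))
  obtain ⟨d1, d2⟩ := abs_le.mp hdi
  have hz0 : 0 ≤ ∫ x, Z x ∂Measure.pi (fun _ => ν) := integral_nonneg fun x => norm_nonneg _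
  rw [e, ← ofReal_norm, ← ENNReal.ofReal_add (norm_nonneg _) (by positivity),
    ← ENNReal.ofReal_add hz0 (by positivity)]
  exact ⟨ENNReal.ofReal_le_ofReal (by linarith), ENNReal.ofReal_le_ofReal (by linarith)⟩

/-- The `L^p` norm of the maximum of independent copies. -/
theorem eLpNorm_pi_le {p : ℝ≥0∞} (hp : 1 ≤ p) (hp' : p ≠ ∞) :
    eLpNorm (fun x : ι → ℝ => x) p (Measure.pi fun _ => ν) ≤
      (Fintype.card ι : ℝ≥0∞) ^ (1 / p.toReal) * eLpNorm (fun y : ℝ => y) p ν := by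
  have hp0 : p ≠ 0 := (zero_lt_one.trans_le hp).ne'
  have hpr : 0 < p.toReal := ENNReal.toReal_pos hp0 hp'
  rw [eLpNorm_eq_lintegral_rpow_enorm_toReal hp0 hp',
    eLpNorm_eq_lintegral_rpow_enorm_toReal hp0 hp', ← ENNReal.mul_rpow_of_nonneg _ _
    (by positivity)]
  gcongr
  calc _ ≤ ∫⁻ x : ι → ℝ, ∑ i, ‖x i‖ₑ ^ p.toReal ∂Measure.pi (fun _ => ν) := by
        refine lintegral_mono fun x => ?_
        rcases isEmpty_or_nonempty ι with h | h
        · have : x = 0 := Subsingleton.elim _ _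
          simp [this, ENNReal.zero_rpow_of_pos hpr]
        · obtain ⟨i, hi⟩ : ∃ i, ‖x‖ₑ = ‖x i‖ₑ := by
            obtain ⟨i, hi⟩ := Finite.exists_max fun i => ‖x i‖
            refine ⟨i, ?_⟩
            rw [← ofReal_norm, ← ofReal_norm]
            congr 1
            exact le_antisymm ((pi_norm_le_iff_of_nonneg (norm_nonneg _)).mpr hi)
              (norm_le_pi_norm x i)
          rw [hi]
          exact Finset.single_le_sum (f := fun i => ‖x i‖ₑ ^ p.toReal) (fun _ _ => zero_le)
            (Finset.mem_univ i)
    _ = _ := by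
        rw [lintegral_finsetSum _ fun i _ => by fun_prop]
        have : ∀ i : ι, ∫⁻ x : ι → ℝ, ‖x i‖ₑ ^ p.toReal ∂Measure.pi (fun _ => ν) =
            ∫⁻ y, ‖y‖ₑ ^ p.toReal ∂ν := fun i =>
          (measurePreserving_eval (fun _ : ι => ν) i).lintegral_comp
            (f := fun y => ‖y‖ₑ ^ p.toReal) (by fun_prop)
        simp [this]

end Deviation

/-! ### Weighted flattenings in a single block -/

section FlatBlock

variable {K I J ι : Type*} [Fintype K] [Fintype I] [DecidableEq I] [Fintype J] [DecidableEq J]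
  [Fintype ι] [DecidableEq ι] {ν : Measure ℝ} [IsProbabilityMeasure ν]

theorem enorm_flat_comm (ρ : K → I) (γ : K → J) (a : K → ℝ) :
    ‖flat ρ γ a‖ₑ = ‖flat γ ρ a‖ₑ := by
  rw [← ofReal_norm, ← ofReal_norm, norm_flat_comm]

theorem continuous_flat {X : Type*} [TopologicalSpace X] (ρ : K → I) (γ : K → J)
    {a : X → K → ℝ} (ha : ∀ k, Continuous fun x => a x k) :
    Continuous fun x => flat ρ γ (a x) := by
  refine continuous_matrix fun i j => ?_
  simp only [flat, Matrix.of_apply]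
  refine continuous_finsetSum _ fun k _ => ?_
  split_ifs
  · exact ha k
  · exact continuous_const

/-- Since the row determines `c`, the flattening has the norm of the row stack of its slices. The
slice bound is the flattening in which `c` also enters the columns. -/
theorem flat_deviation_of_row (c : K → ι) (ρ : K → I) (γ : K → J) (a : K → ℝ)
    (hc : ∀ k k', ρ k = ρ k' → c k = c k') (hν : MemLp (fun y => y) 2 ν)
    (h1 : ∫ y, y ^ 2 ∂ν = 1) {l S : ℝ} (hl : 1 ≤ l) (hS : 1 ≤ S)
    (hn : (2 * Fintype.card J : ℝ) ≤ Real.exp l)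
    (hxS : eLpNorm (fun x : ι → ℝ => x) 2 (Measure.pi fun _ => ν) ≤ ENNReal.ofReal S) :
    ∫⁻ y, ‖flat ρ γ fun k => y (c k) * a k‖ₑ ∂Measure.pi (fun _ : ι => ν) ≤
        ‖flat ρ γ a‖ₑ + ENNReal.ofReal (96 * √l * S) * ‖flat ρ (fun k => (c k, γ k)) a‖ₑ ∧
    ‖flat ρ γ a‖ₑ ≤ ∫⁻ y, ‖flat ρ γ fun k => y (c k) * a k‖ₑ ∂Measure.pi (fun _ : ι => ν) +
        ENNReal.ofReal (96 * √l * S) * ‖flat ρ (fun k => (c k, γ k)) a‖ₑ := by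
  have hρ : ∀ k k', ρ k = ρ k' ↔ (c k, ρ k) = (c k', ρ k') := by
    intro k k'
    rw [Prod.mk.injEq]
    exact ⟨fun h => ⟨hc _ _ h, h⟩, fun h => h.2⟩
  have e1 : ∀ y : ι → ℝ, ‖flat ρ γ fun k => y (c k) * a k‖ₑ =
      ‖rowStack fun i => y i • slice c ρ γ a i‖ₑ := by
    intro y
    rw [rowStack_smul_slice, ← ofReal_norm, ← ofReal_norm]
    congr 1
    exact norm_flat_congr _ _ _ _ _ hρ fun _ _ => Iff.rfl
  have e2 : ‖flat ρ γ a‖ₑ = ‖rowStack (slice c ρ γ a)‖ₑ := by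
    have := e1 fun _ => 1
    simpa using this
  have e3 : ‖flat ρ (fun k => (c k, γ k)) a‖ =
      ‖flat (fun k => (c k, ρ k)) (fun k => (c k, γ k)) a‖ :=
    norm_flat_congr _ _ _ _ _ hρ fun _ _ => Iff.rfl
  have h := lintegral_enorm_rowStack_deviation (slice c ρ γ a) hν h1 hl (norm_nonneg _) hS hn
    (norm_slice_le c ρ γ a) hxS
  rw [← e3, ← e2, show 96 * √l * ‖flat ρ (fun k => (c k, γ k)) a‖ * S =
    96 * √l * S * ‖flat ρ (fun k => (c k, γ k)) a‖ by ring,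
    ENNReal.ofReal_mul (by positivity), ofReal_norm] at h
  simpa only [e1] using h

theorem flat_weight_le_of_row (c : K → ι) (ρ : K → I) (γ : K → J) (a : K → ℝ)
    (hc : ∀ k k', ρ k = ρ k' → c k = c k') {S : ℝ}
    (hxS : eLpNorm (fun x : ι → ℝ => x) 2 (Measure.pi fun _ => ν) ≤ ENNReal.ofReal S) :
    ∫⁻ y, ‖flat ρ γ fun k => y (c k) * a k‖ₑ ∂Measure.pi (fun _ : ι => ν) ≤
        ENNReal.ofReal S * ‖flat ρ γ a‖ₑ := by
  have hρ : ∀ k k', ρ k = ρ k' ↔ (c k, ρ k) = (c k', ρ k') := by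
    intro k k'
    rw [Prod.mk.injEq]
    exact ⟨fun h => ⟨hc _ _ h, h⟩, fun h => h.2⟩
  have e1 : ∀ y : ι → ℝ, ‖flat ρ γ fun k => y (c k) * a k‖ =
      ‖rowStack fun i => y i • slice c ρ γ a i‖ := by
    intro y
    rw [rowStack_smul_slice]
    exact norm_flat_congr _ _ _ _ _ hρ fun _ _ => Iff.rfl
  have e2 : ‖flat ρ γ a‖ = ‖rowStack (slice c ρ γ a)‖ := by
    have := e1 fun _ => 1
    simpa using this
  calc _ ≤ ∫⁻ y, ‖y‖ₑ * ‖flat ρ γ a‖ₑ ∂Measure.pi (fun _ : ι => ν) := by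
        refine lintegral_mono fun y => ?_
        rw [← ofReal_norm, ← ofReal_norm, ← ofReal_norm, ← ENNReal.ofReal_mul (norm_nonneg _),
          e1, e2]
        exact ENNReal.ofReal_le_ofReal
          (norm_rowStack_smul_le _ y (norm_nonneg _) (norm_le_pi_norm y))
    _ = eLpNorm (fun x : ι → ℝ => x) 1 (Measure.pi fun _ => ν) * ‖flat ρ γ a‖ₑ := by
        rw [lintegral_mul_const' _ _ enorm_ne_top, eLpNorm_one_eq_lintegral_enorm]
    _ ≤ _ := by
        gcongr
        exact (eLpNorm_le_eLpNorm_of_exponent_le one_le_two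
          continuous_id.aestronglyMeasurable).trans hxS

end FlatBlock

/-! ### Moving chaos coordinates into rows and columns -/

section Iteration

variable {q m d₁ d₂ : ℕ}

/-- Full multi-indices of the coefficient tensor. -/
abbrev FullIndex (q m d₁ d₂ : ℕ) : Type := (t : Coord q) → Fin (coordDim m d₁ d₂ t)

/-- The value of a chaos coordinate. -/
def chaosCoord (t : Fin q) (k : FullIndex q m d₁ d₂) : Fin m := k (Sum.inl t)

/-- Restriction of a full multi-index to a set of coordinates. -/
def res (R : Finset (Coord q)) (k : FullIndex q m d₁ d₂) : MultiIndex m d₁ d₂ R := fun t => k t.1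

/-- The product of the random coefficients of the coordinates in `S`. -/
noncomputable def weight (S : Finset (Fin q)) (x : Fin q → Fin m → ℝ)
    (k : FullIndex q m d₁ d₂) : ℝ := ∏ t ∈ S, x t (chaosCoord t k)

theorem flattening_eq_flat (A : (Fin q → Fin m) → Matrix (Fin d₁) (Fin d₂) ℝ)
    (R C : Finset (Coord q)) : flattening A R C = flat (res R) (res C) (tensor A) := by
  ext ρ γ
  simp only [flattening, flat, Matrix.of_apply, res, funext_iff]
  refine Finset.sum_congr rfl fun k _ => ?_
  by_cases h1 : ∀ t : R, k t.1 = ρ t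
  · by_cases h2 : ∀ t : C, k t.1 = γ t
    · rw [if_pos h1, if_pos h2, if_pos ⟨h1, h2⟩, one_mul, one_mul]
    · rw [if_neg h2, mul_zero, zero_mul, if_neg fun h => h2 h.2]
  · rw [if_neg h1, zero_mul, zero_mul, if_neg fun h => h1 h.1]

theorem res_insert (t : Fin q) (R : Finset (Coord q)) (k k' : FullIndex q m d₁ d₂) :
    res (insert (Sum.inl t) R) k = res (insert (Sum.inl t) R) k' ↔
      (chaosCoord t k, res R k) = (chaosCoord t k', res R k') := by
  rw [Prod.mk.injEq]
  constructor
  · intro h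
    exact ⟨congrFun h ⟨Sum.inl t, Finset.mem_insert_self _ _⟩,
      funext fun s => congrFun h ⟨s.1, Finset.mem_insert_of_mem s.2⟩⟩
  · rintro ⟨h1, h2⟩
    funext ⟨s, hs⟩
    rcases Finset.mem_insert.mp hs with rfl | hs
    · exact h1
    · exact congrFun h2 ⟨s, hs⟩

theorem chaosCoord_eq_of_res_eq {t : Fin q} {R : Finset (Coord q)} (ht : Sum.inl t ∈ R)
    (k k' : FullIndex q m d₁ d₂) (h : res R k = res R k') : chaosCoord t k = chaosCoord t k' :=
  congrFun h ⟨Sum.inl t, ht⟩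

theorem weight_insert_update {S : Finset (Fin q)} {t : Fin q} (ht : t ∉ S)
    (x : Fin q → Fin m → ℝ) (y : Fin m → ℝ) (k : FullIndex q m d₁ d₂) :
    weight (insert t S) (Function.update x t y) k = y (chaosCoord t k) * weight S x k := by
  rw [weight, Finset.prod_insert ht, Function.update_self]
  congr 1
  refine Finset.prod_congr rfl fun s hs => ?_
  rw [Function.update_of_ne (by rintro rfl; exact ht hs)]

theorem card_multiIndex_le (R : Finset (Coord q)) {L : ℝ} (hL : 0 ≤ L)
    (hN : ((max d₁ d₂ + m : ℕ) : ℝ) ≤ Real.exp L) :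
    (Fintype.card (MultiIndex m d₁ d₂ R) : ℝ) ≤ Real.exp ((q + 2) * L) := by
  have hdim : ∀ t : Coord q, (coordDim m d₁ d₂ t : ℝ) ≤ Real.exp L := by
    intro t
    refine le_trans ?_ hN
    norm_cast
    rcases t with t | t
    · simp [coordDim]
    · fin_cases t
      · exact (le_max_left d₁ d₂).trans (Nat.le_add_right _ _)
      · exact (le_max_right d₁ d₂).trans (Nat.le_add_right _ _)
  rw [Fintype.card_pi]
  push_cast
  calc ∏ t : R, (Fintype.card (Fin (coordDim m d₁ d₂ t.1)) : ℝ) ≤ ∏ _t : R, Real.exp L := by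
        refine Finset.prod_le_prod (fun _ _ => by positivity) fun t _ => ?_
        rw [Fintype.card_fin]; exact hdim _
    _ = Real.exp L ^ R.card := by simp
    _ ≤ Real.exp L ^ (q + 2) := by
        refine pow_le_pow_right₀ (Real.one_le_exp hL) ?_
        have := Finset.card_le_univ R
        simpa using this
    _ = _ := by rw [← Real.exp_nat_mul]; push_cast; rfl

/-- Each side of a flattening has at most `exp ((q+2) L)` indices; one more factor `exp L` absorbs
the two sides of the dilation. This is where `q + 3` comes from. -/
theorem two_mul_exp_le {L : ℝ} (hL : 2 ≤ L) :
    2 * Real.exp ((q + 2) * L) ≤ Real.exp ((q + 3) * L) := by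
  have h : (q + 3 : ℝ) * L = L + (q + 2) * L := by ring
  rw [h, Real.exp_add]
  gcongr
  linarith [Real.add_one_le_exp L]

variable (ν : Measure ℝ) [IsProbabilityMeasure ν] (a : FullIndex q m d₁ d₂ → ℝ)

/-- The joint law of the `q` independent blocks of `m` coefficients. -/
noncomputable def blockLaw (q m : ℕ) : Measure (Fin q → Fin m → ℝ) :=
  Measure.pi fun _ => Measure.pi fun _ => ν

instance : IsProbabilityMeasure (blockLaw ν q m) := by unfold blockLaw; infer_instance

/-- The expected norm of the flattening of `a` weighted by the random coefficients of the
coordinates in `S`. -/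
noncomputable def meanNorm (S : Finset (Fin q)) (R C : Finset (Coord q)) : ℝ≥0∞ :=
  ∫⁻ x, ‖flat (res R) (res C) fun k => weight S x k * a k‖ₑ ∂blockLaw ν q m

theorem measurable_enorm_flat_weight (S : Finset (Fin q)) (R C : Finset (Coord q)) :
    Measurable fun x : Fin q → Fin m → ℝ =>
      ‖flat (res R) (res C) fun k => weight S x k * a k‖ₑ := by
  have h : Continuous fun x : Fin q → Fin m → ℝ =>
      flat (res R) (res C) fun k => weight S x k * a k := by
    refine continuous_flat _ _ fun k => ?_
    unfold weight
    fun_prop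
  exact h.enorm.measurable

theorem measurable_lintegral_flat_weight (S : Finset (Fin q)) (R C : Finset (Coord q))
    (t : Fin q) :
    Measurable fun x : Fin q → Fin m → ℝ => ∫⁻ y : Fin m → ℝ,
      ‖flat (res R) (res C) fun k => y (chaosCoord t k) * (weight S x k * a k)‖ₑ
        ∂Measure.pi (fun _ => ν) := by
  have h : Continuous fun p : (Fin q → Fin m → ℝ) × (Fin m → ℝ) =>
      flat (res R) (res C) fun k => p.2 (chaosCoord t k) * (weight S p.1 k * a k) := by
    refine continuous_flat _ _ fun k => ?_
    unfold weight
    fun_prop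
  exact h.enorm.measurable.lintegral_prod_right'

theorem meanNorm_insert {S : Finset (Fin q)} {t : Fin q} (ht : t ∉ S) (R C : Finset (Coord q)) :
    meanNorm ν a (insert t S) R C = ∫⁻ x, ∫⁻ y : Fin m → ℝ,
      ‖flat (res R) (res C) fun k => y (chaosCoord t k) * (weight S x k * a k)‖ₑ
        ∂Measure.pi (fun _ => ν) ∂blockLaw ν q m := by
  unfold meanNorm blockLaw
  rw [lintegral_pi_update _ t (measurable_enorm_flat_weight a (insert t S) R C)]
  simp only [weight_insert_update ht, mul_assoc]

theorem meanNorm_comm (S : Finset (Fin q)) (R C : Finset (Coord q)) :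
    meanNorm ν a S R C = meanNorm ν a S C R := by
  unfold meanNorm
  simp only [enorm_flat_comm (res R)]

theorem meanNorm_empty (R C : Finset (Coord q)) :
    meanNorm ν a ∅ R C = ‖flat (res R) (res C) a‖ₑ := by
  simp [meanNorm, weight]

variable {ν}

theorem enorm_flat_insert_row (t : Fin q) (R C : Finset (Coord q)) (b : FullIndex q m d₁ d₂ → ℝ) :
    ‖flat (res (insert (Sum.inl t) R)) (res C) b‖ₑ =
      ‖flat (fun k => (chaosCoord t k, res R k)) (res C) b‖ₑ := by
  rw [← ofReal_norm, ← ofReal_norm]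
  congr 1
  exact norm_flat_congr _ _ _ _ _ (res_insert t R) fun _ _ => Iff.rfl

theorem enorm_flat_insert_col (t : Fin q) (R C : Finset (Coord q)) (b : FullIndex q m d₁ d₂ → ℝ) :
    ‖flat (res R) (res (insert (Sum.inl t) C)) b‖ₑ =
      ‖flat (res R) (fun k => (chaosCoord t k, res C k)) b‖ₑ := by
  rw [enorm_flat_comm, enorm_flat_insert_row, enorm_flat_comm]

/-- Khintchine in the block `t`, with the other blocks frozen. The weight of `t` remains in the new
flattenings. -/
theorem meanNorm_le_insert_add (hi : Integrable (fun y => y) ν) (h0 : ∫ y, y ∂ν = 0)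
    {L : ℝ} (hL : 2 ≤ L) (hN : ((max d₁ d₂ + m : ℕ) : ℝ) ≤ Real.exp L)
    {S : Finset (Fin q)} {t : Fin q} (ht : t ∈ S) (R C : Finset (Coord q)) :
    meanNorm ν a S R C ≤ ENNReal.ofReal (16 * √((q + 3) * L)) *
      (meanNorm ν a S (insert (Sum.inl t) R) C + meanNorm ν a S R (insert (Sum.inl t) C)) := by
  have hn : (Fintype.card (MultiIndex m d₁ d₂ R) + Fintype.card (MultiIndex m d₁ d₂ C) : ℝ) ≤
      Real.exp ((q + 3) * L) := by
    refine le_trans ?_ (two_mul_exp_le hL)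
    rw [two_mul]
    exact add_le_add (card_multiIndex_le R (by linarith) hN)
      (card_multiIndex_le C (by linarith) hN)
  have hl : 1 ≤ (q + 3 : ℝ) * L := by
    have : (0 : ℝ) ≤ q := by positivity
    nlinarith
  rw [← Finset.insert_erase ht]
  have htS := Finset.notMem_erase t S
  rw [meanNorm_insert ν a htS, meanNorm_insert ν a htS, meanNorm_insert ν a htS,
    ← lintegral_add_left (measurable_lintegral_flat_weight ν a _ _ _ t),
    ← lintegral_const_mul' _ _ ENNReal.ofReal_ne_top]
  refine lintegral_mono fun x => ?_
  have h := lintegral_enorm_sum_le_stack ν (slice (chaosCoord t) (res R) (res C)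
    fun k => weight (S.erase t) x k * a k) hi h0 hl hn
  simpa only [sum_smul_slice, rowStack_smul_slice, colStack_smul_slice, enorm_flat_insert_row,
    enorm_flat_insert_col] using h

theorem meanNorm_insert_le (hi : Integrable (fun y => y) ν) (h0 : ∫ y, y ∂ν = 0)
    {S : Finset (Fin q)} {t : Fin q} (ht : t ∈ S) (R C : Finset (Coord q)) :
    meanNorm ν a S (insert (Sum.inl t) R) C ≤ 4 * meanNorm ν a S R C := by
  rw [← Finset.insert_erase ht]
  have htS := Finset.notMem_erase t S
  rw [meanNorm_insert ν a htS, meanNorm_insert ν a htS,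
    ← lintegral_const_mul' _ _ ENNReal.ofNat_ne_top]
  refine lintegral_mono fun x => ?_
  have h := lintegral_enorm_rowStack_le ν (slice (chaosCoord t) (res R) (res C)
    fun k => weight (S.erase t) x k * a k) hi h0
  simpa only [sum_smul_slice, rowStack_smul_slice, enorm_flat_insert_row] using h

theorem meanNorm_image_union_le (hi : Integrable (fun y => y) ν) (h0 : ∫ y, y ∂ν = 0)
    (T : Finset (Fin q)) (R C : Finset (Coord q)) :
    meanNorm ν a Finset.univ (T.image Sum.inl ∪ R) C ≤ 4 ^ q * meanNorm ν a Finset.univ R C := by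
  have key : meanNorm ν a Finset.univ (T.image Sum.inl ∪ R) C ≤
      4 ^ T.card * meanNorm ν a Finset.univ R C := by
    induction T using Finset.induction_on with
    | empty => simp
    | insert t T ht ih =>
      rw [Finset.image_insert, Finset.insert_union, Finset.card_insert_of_notMem ht, pow_succ',
        mul_assoc]
      exact (meanNorm_insert_le a hi h0 (Finset.mem_univ t) _ _).trans (by gcongr)
  refine key.trans ?_
  gcongr
  · norm_num
  · simpa using Finset.card_le_univ T

theorem exists_partition_meanNorm_le (hi : Integrable (fun y => y) ν) (h0 : ∫ y, y ∂ν = 0)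
    {L : ℝ} (hL : 2 ≤ L) (hN : ((max d₁ d₂ + m : ℕ) : ℝ) ≤ Real.exp L) (T : Finset (Fin q)) :
    ∃ R C : Finset (Coord q), Sum.inr 0 ∈ R ∧ Sum.inr 1 ∈ C ∧ Disjoint R C ∧
      R ∪ C = T.image Sum.inl ∪ {Sum.inr 0, Sum.inr 1} ∧
      meanNorm ν a Finset.univ {Sum.inr 0} {Sum.inr 1} ≤
        ENNReal.ofReal (32 * √((q + 3) * L)) ^ T.card * meanNorm ν a Finset.univ R C := by
  induction T using Finset.induction_on with
  | empty => exact ⟨{Sum.inr 0}, {Sum.inr 1}, by simp, by simp, by simp, by simp, by simp⟩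
  | insert t T ht ih =>
    obtain ⟨R, C, hR, hC, hd, hu, hle⟩ := ih
    have htRC : Sum.inl t ∉ R ∪ C := by rw [hu]; simp [ht]
    rw [Finset.notMem_union] at htRC
    have h := meanNorm_le_insert_add a hi h0 hL hN (Finset.mem_univ t) R C
    have e32 : ENNReal.ofReal (32 * √((q + 3) * L)) =
        ENNReal.ofReal (16 * √((q + 3) * L)) * 2 := by
      rw [show 32 * √((q + 3) * L) = 16 * √((q + 3) * L) * 2 by ring,
        ENNReal.ofReal_mul (by positivity), ENNReal.ofReal_ofNat]
    have step : ∀ M : ℝ≥0∞, meanNorm ν a Finset.univ (insert (Sum.inl t) R) C ≤ M →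
        meanNorm ν a Finset.univ R (insert (Sum.inl t) C) ≤ M →
        meanNorm ν a Finset.univ {Sum.inr 0} {Sum.inr 1} ≤
          ENNReal.ofReal (32 * √((q + 3) * L)) ^ (insert t T).card * M := by
      intro M h1 h2
      rw [Finset.card_insert_of_notMem ht, pow_succ, mul_assoc]
      refine hle.trans ?_
      gcongr
      refine h.trans ?_
      rw [e32, mul_assoc, two_mul]
      gcongr
    -- Keeping the larger of the two flattenings doubles the constant `16` and avoids a sum over all
    -- partitions.
    rcases le_total (meanNorm ν a Finset.univ (insert (Sum.inl t) R) C)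
      (meanNorm ν a Finset.univ R (insert (Sum.inl t) C)) with hcmp | hcmp
    · refine ⟨R, insert (Sum.inl t) C, hR, Finset.mem_insert_of_mem hC,
        Finset.disjoint_insert_right.mpr ⟨htRC.1, hd⟩, ?_, step _ hcmp le_rfl⟩
      rw [Finset.union_insert, hu, Finset.image_insert, Finset.insert_union]
    · refine ⟨insert (Sum.inl t) R, C, Finset.mem_insert_of_mem hR, hC,
        Finset.disjoint_insert_left.mpr ⟨htRC.2, hd⟩, ?_, step _ le_rfl hcmp⟩
      rw [Finset.insert_union, hu, Finset.image_insert, Finset.insert_union]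

theorem meanNorm_insert_weight_le {S₀ : ℝ}
    (hxS : eLpNorm (fun x : Fin m → ℝ => x) 2 (Measure.pi fun _ => ν) ≤ ENNReal.ofReal S₀)
    {S : Finset (Fin q)} {t : Fin q} (ht : t ∉ S) {R C : Finset (Coord q)}
    (htRC : Sum.inl t ∈ R ∪ C) :
    meanNorm ν a (insert t S) R C ≤ ENNReal.ofReal S₀ * meanNorm ν a S R C := by
  wlog hR : Sum.inl t ∈ R generalizing R C
  · rw [meanNorm_comm, meanNorm_comm ν a S]
    exact this (by rwa [Finset.union_comm]) ((Finset.mem_union.mp htRC).resolve_left hR)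
  rw [meanNorm_insert ν a ht, meanNorm, ← lintegral_const_mul' _ _ ENNReal.ofReal_ne_top]
  exact lintegral_mono fun x =>
    flat_weight_le_of_row _ _ _ _ (chaosCoord_eq_of_res_eq hR) hxS

/-- When every coordinate is in the rows or the columns, a weight multiplies whole rows or whole
columns, so each block costs at most the mean of its maximum. -/
theorem meanNorm_le_pow_mul {S₀ : ℝ}
    (hxS : eLpNorm (fun x : Fin m → ℝ => x) 2 (Measure.pi fun _ => ν) ≤ ENNReal.ofReal S₀)
    (S : Finset (Fin q)) {R C : Finset (Coord q)} (hRC : R ∪ C = Finset.univ) :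
    meanNorm ν a S R C ≤ ENNReal.ofReal S₀ ^ S.card * ‖flat (res R) (res C) a‖ₑ := by
  induction S using Finset.induction_on with
  | empty => simp [meanNorm_empty]
  | insert t S ht ih =>
    rw [Finset.card_insert_of_notMem ht, pow_succ', mul_assoc]
    refine (meanNorm_insert_weight_le a hxS ht (by rw [hRC]; exact Finset.mem_univ _)).trans ?_
    gcongr

theorem meanNorm_insert_deviation (hν : MemLp (fun y => y) 2 ν) (h1 : ∫ y, y ^ 2 ∂ν = 1)
    {L S₀ : ℝ} (hL : 2 ≤ L) (hN : ((max d₁ d₂ + m : ℕ) : ℝ) ≤ Real.exp L) (hS₀ : 1 ≤ S₀)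
    (hxS : eLpNorm (fun x : Fin m → ℝ => x) 2 (Measure.pi fun _ => ν) ≤ ENNReal.ofReal S₀)
    {S : Finset (Fin q)} {t : Fin q} (ht : t ∉ S) {R C : Finset (Coord q)}
    (hR : Sum.inl t ∈ R) :
    meanNorm ν a (insert t S) R C ≤ meanNorm ν a S R C +
      ENNReal.ofReal (96 * √((q + 3) * L) * S₀) * meanNorm ν a S R (insert (Sum.inl t) C) ∧
    meanNorm ν a S R C ≤ meanNorm ν a (insert t S) R C +
      ENNReal.ofReal (96 * √((q + 3) * L) * S₀) * meanNorm ν a S R (insert (Sum.inl t) C) := by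
  have hn : (2 * Fintype.card (MultiIndex m d₁ d₂ C) : ℝ) ≤ Real.exp ((q + 3) * L) := by
    refine le_trans ?_ (two_mul_exp_le hL)
    gcongr
    exact card_multiIndex_le C (by linarith) hN
  have hl : 1 ≤ (q + 3 : ℝ) * L := by
    have : (0 : ℝ) ≤ q := by positivity
    nlinarith
  have h := fun x => flat_deviation_of_row (chaosCoord t) (res R) (res C)
    (fun k => weight S x k * a k) (chaosCoord_eq_of_res_eq hR) hν h1 hl hS₀ hn hxS
  simp only [← enorm_flat_insert_col] at h
  rw [meanNorm_insert ν a ht]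
  unfold meanNorm
  rw [← lintegral_const_mul' _ _ ENNReal.ofReal_ne_top]
  constructor
  · rw [← lintegral_add_left (measurable_enorm_flat_weight a S R C)]
    exact lintegral_mono fun x => (h x).1
  · rw [← lintegral_add_left (measurable_lintegral_flat_weight ν a _ _ _ t)]
    exact lintegral_mono fun x => (h x).2

end Iteration

/-! ### Bounds in terms of the two parameters -/

section Assembly

variable {q m d₁ d₂ : ℕ} (A : (Fin q → Fin m) → Matrix (Fin d₁) (Fin d₂) ℝ)
  {ν : Measure ℝ} [IsProbabilityMeasure ν]

theorem enorm_flat_le_sigmaParam {R C : Finset (Coord q)} (hR : Sum.inr 0 ∈ R)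
    (hC : Sum.inr 1 ∈ C) (hd : Disjoint R C) (hu : R ∪ C = Finset.univ) :
    ‖flat (res R) (res C) (tensor A)‖ₑ ≤ (sigmaParam A : ℝ≥0∞) := by
  rw [← flattening_eq_flat, enorm_eq_nnnorm, ENNReal.coe_le_coe]
  refine Finset.le_sup (f := fun RC : Finset (Coord q) × Finset (Coord q) =>
    ‖flattening A RC.1 RC.2‖₊) (b := (R, C)) ?_
  simp only [Finset.mem_filter, Finset.mem_univ, true_and]
  refine ⟨?_, hR, hC⟩
  have : IsCompl R C := ⟨hd, codisjoint_iff.mpr hu⟩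
  exact this.symm.compl_eq.symm

theorem enorm_flat_le_rParam {R C : Finset (Coord q)} (hR : Sum.inr 0 ∈ R)
    (hC : Sum.inr 1 ∈ C) (hd : Disjoint R C) (hu : R ∪ C = Finset.univ) (t : Fin q) :
    ‖flat (res (insert (Sum.inl t) R)) (res (insert (Sum.inl t) C)) (tensor A)‖ₑ ≤
      (rParam A : ℝ≥0∞) := by
  rw [← flattening_eq_flat, enorm_eq_nnnorm, ENNReal.coe_le_coe]
  refine Finset.le_sup (f := fun RC : Finset (Coord q) × Finset (Coord q) =>
    ‖flattening A RC.1 RC.2‖₊) (b := (insert (Sum.inl t) R, insert (Sum.inl t) C)) ?_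
  simp only [Finset.mem_filter, Finset.mem_univ, true_and]
  refine ⟨?_, Finset.mem_insert_of_mem hR, Finset.mem_insert_of_mem hC,
    ⟨Sum.inl t, by simp⟩, ?_⟩
  · rw [Finset.insert_union, Finset.union_insert, hu]; simp
  · rw [← Finset.insert_inter_distrib, Finset.disjoint_iff_inter_eq_empty.mp hd]
    intro x hx
    exact ⟨t, by simpa using hx⟩

/-- Replacing all random coefficients by one changes the mean norm by a multiple of `r`. -/
theorem meanNorm_deviation (hν : MemLp (fun y => y) 2 ν) (h1 : ∫ y, y ^ 2 ∂ν = 1)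
    {L S₀ : ℝ} (hL : 2 ≤ L) (hN : ((max d₁ d₂ + m : ℕ) : ℝ) ≤ Real.exp L) (hS₀ : 1 ≤ S₀)
    (hxS : eLpNorm (fun x : Fin m → ℝ => x) 2 (Measure.pi fun _ => ν) ≤ ENNReal.ofReal S₀)
    {R C : Finset (Coord q)} (hR : Sum.inr 0 ∈ R)
    (hC : Sum.inr 1 ∈ C) (hd : Disjoint R C) (hu : R ∪ C = Finset.univ) (S : Finset (Fin q)) :
    meanNorm ν (tensor A) S R C ≤ ‖flat (res R) (res C) (tensor A)‖ₑ +
      S.card * (ENNReal.ofReal (96 * √((q + 3) * L)) * ENNReal.ofReal S₀ ^ q * rParam A) ∧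
    ‖flat (res R) (res C) (tensor A)‖ₑ ≤ meanNorm ν (tensor A) S R C +
      S.card * (ENNReal.ofReal (96 * √((q + 3) * L)) * ENNReal.ofReal S₀ ^ q * rParam A) := by
  set κ := ENNReal.ofReal (96 * √((q + 3) * L)) * ENNReal.ofReal S₀ ^ q * rParam A with hκ
  induction S using Finset.induction_on with
  | empty => simp [meanNorm_empty]
  | insert t S ht ih =>
    have hcard : S.card + 1 ≤ q := by
      have := Finset.card_le_univ (insert t S)
      rwa [Finset.card_insert_of_notMem ht, Fintype.card_fin] at this
    have hS1 : 1 ≤ ENNReal.ofReal S₀ := by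
      rw [← ENNReal.ofReal_one]; exact ENNReal.ofReal_le_ofReal hS₀
    -- The weights still present contribute `S₀ ^ S.card`, the deviation one more `S₀`; since `S₀ ≥
    -- 1` and `S.card + 1 ≤ q`, the total is at most `S₀ ^ q`.
    have hb : ∀ M : ℝ≥0∞, M ≤ ENNReal.ofReal S₀ ^ S.card * rParam A →
        ENNReal.ofReal (96 * √((q + 3) * L) * S₀) * M ≤ κ := by
      intro M hM
      rw [ENNReal.ofReal_mul (by positivity), hκ, mul_assoc, mul_assoc]
      refine mul_le_mul' le_rfl ?_
      calc _ ≤ ENNReal.ofReal S₀ * (ENNReal.ofReal S₀ ^ S.card * rParam A) := by gcongr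
        _ = ENNReal.ofReal S₀ ^ (S.card + 1) * rParam A := by ring
        _ ≤ _ := mul_le_mul' (pow_le_pow_right₀ hS1 hcard) le_rfl
    have step : meanNorm ν (tensor A) (insert t S) R C ≤ meanNorm ν (tensor A) S R C + κ ∧
        meanNorm ν (tensor A) S R C ≤ meanNorm ν (tensor A) (insert t S) R C + κ := by
      have hr := enorm_flat_le_rParam A hR hC hd hu t
      -- The coordinate lies on one side, and the error term adds it to the other, so exactly this
      -- coordinate is shared. The column case is the row case transposed.
      rcases Finset.mem_union.mp (hu ▸ Finset.mem_univ (Sum.inl t) : Sum.inl t ∈ R ∪ C) with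
        htR | htC
      · obtain ⟨s1, s2⟩ := meanNorm_insert_deviation (tensor A) hν h1 hL hN hS₀ hxS ht
          (C := C) htR
        rw [Finset.insert_eq_of_mem htR] at hr
        have hM := (meanNorm_le_pow_mul (tensor A) hxS S (R := R) (C := insert (Sum.inl t) C)
          (by rw [Finset.union_insert, hu]; simp)).trans (mul_le_mul' le_rfl hr)
        exact ⟨s1.trans (by gcongr; exact hb _ hM), s2.trans (by gcongr; exact hb _ hM)⟩
      · obtain ⟨s1, s2⟩ := meanNorm_insert_deviation (tensor A) hν h1 hL hN hS₀ hxS ht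
          (C := R) htC
        rw [Finset.insert_eq_of_mem htC, enorm_flat_comm] at hr
        have hM := (meanNorm_le_pow_mul (tensor A) hxS S (R := C) (C := insert (Sum.inl t) R)
          (by rw [Finset.union_insert, Finset.union_comm, hu]; simp)).trans (mul_le_mul' le_rfl hr)
        rw [meanNorm_comm ν _ _ R C, meanNorm_comm ν _ _ R C]
        exact ⟨s1.trans (by gcongr; exact hb _ hM), s2.trans (by gcongr; exact hb _ hM)⟩
    rw [Finset.card_insert_of_notMem ht]
    push_cast
    rw [add_mul, one_mul]
    refine ⟨step.1.trans ?_, ih.2.trans ?_⟩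
    · rw [← add_assoc]; exact add_le_add ih.1 le_rfl
    · rw [add_comm _ κ, ← add_assoc]; exact add_le_add step.2 le_rfl

theorem image_inl_union : (Finset.univ : Finset (Fin q)).image Sum.inl ∪
    {Sum.inr 0, Sum.inr 1} = (Finset.univ : Finset (Coord q)) := by
  ext x
  rcases x with t | t
  · simp
  · fin_cases t <;> simp

/-- A cruder bound without `r`: the weights are pulled out at full cost `S₀ ^ q`. It serves the
small dimensions, where `S₀` is an absolute constant. -/
theorem meanNorm_le_sigmaParam (hi : Integrable (fun y => y) ν) (h0 : ∫ y, y ∂ν = 0)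
    {L S₀ : ℝ} (hL : 2 ≤ L) (hN : ((max d₁ d₂ + m : ℕ) : ℝ) ≤ Real.exp L)
    (hxS : eLpNorm (fun x : Fin m → ℝ => x) 2 (Measure.pi fun _ => ν) ≤ ENNReal.ofReal S₀) :
    meanNorm ν (tensor A) Finset.univ {Sum.inr 0} {Sum.inr 1} ≤
      ENNReal.ofReal (32 * √((q + 3) * L)) ^ q * (ENNReal.ofReal S₀ ^ q * sigmaParam A) := by
  obtain ⟨R, C, hR, hC, hd, hu, hle⟩ :=
    exists_partition_meanNorm_le (tensor A) hi h0 hL hN Finset.univ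
  rw [image_inl_union] at hu
  rw [Finset.card_univ, Fintype.card_fin] at hle
  refine hle.trans ?_
  gcongr
  have := meanNorm_le_pow_mul (tensor A) hxS Finset.univ hu
  rw [Finset.card_univ, Fintype.card_fin] at this
  refine this.trans ?_
  gcongr
  exact enorm_flat_le_sigmaParam A hR hC hd hu

theorem meanNorm_le_sigmaParam_add (hν : MemLp (fun y => y) 2 ν) (h0 : ∫ y, y ∂ν = 0)
    (h1 : ∫ y, y ^ 2 ∂ν = 1)
    {L S₀ : ℝ} (hL : 2 ≤ L) (hN : ((max d₁ d₂ + m : ℕ) : ℝ) ≤ Real.exp L) (hS₀ : 1 ≤ S₀)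
    (hxS : eLpNorm (fun x : Fin m → ℝ => x) 2 (Measure.pi fun _ => ν) ≤ ENNReal.ofReal S₀) :
    meanNorm ν (tensor A) Finset.univ {Sum.inr 0} {Sum.inr 1} ≤
      ENNReal.ofReal (32 * √((q + 3) * L)) ^ q * (sigmaParam A +
        q * (ENNReal.ofReal (96 * √((q + 3) * L)) * ENNReal.ofReal S₀ ^ q * rParam A)) := by
  obtain ⟨R, C, hR, hC, hd, hu, hle⟩ :=
    exists_partition_meanNorm_le (tensor A) (hν.integrable one_le_two) h0 hL hN Finset.univ
  rw [image_inl_union] at hu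
  rw [Finset.card_univ, Fintype.card_fin] at hle
  refine hle.trans ?_
  gcongr
  have := (meanNorm_deviation A hν h1 hL hN hS₀ hxS hR hC hd hu Finset.univ).1
  rw [Finset.card_univ, Fintype.card_fin] at this
  refine this.trans ?_
  gcongr
  exact enorm_flat_le_sigmaParam A hR hC hd hu

theorem eq_image_inl_union {R : Finset (Coord q)} {s s' : Fin 2} (hs : Sum.inr s ∈ R)
    (hs' : Sum.inr s' ∉ R) (hss : s ≠ s') :
    ∃ T : Finset (Fin q), R = T.image Sum.inl ∪ {Sum.inr s} := by
  refine ⟨Finset.univ.filter fun t => Sum.inl t ∈ R, ?_⟩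
  ext x
  rcases x with t | t
  · simp
  · by_cases h : t = s
    · subst h; simpa using hs
    · have : t = s' := by omega
      subst this
      simpa [h] using hs'

/-- Each `σ`-flattening is compared with its weighted mean, then its chaos coordinates are removed
from the rows and from the columns. Each of these two removals costs at most `4 ^ q`, together `16 ^
q`. -/
theorem sigmaParam_le_meanNorm_add (hν : MemLp (fun y => y) 2 ν) (h0 : ∫ y, y ∂ν = 0)
    (h1 : ∫ y, y ^ 2 ∂ν = 1)
    {L S₀ : ℝ} (hL : 2 ≤ L) (hN : ((max d₁ d₂ + m : ℕ) : ℝ) ≤ Real.exp L) (hS₀ : 1 ≤ S₀)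
    (hxS : eLpNorm (fun x : Fin m → ℝ => x) 2 (Measure.pi fun _ => ν) ≤ ENNReal.ofReal S₀) :
    (sigmaParam A : ℝ≥0∞) ≤
      16 ^ q * meanNorm ν (tensor A) Finset.univ {Sum.inr 0} {Sum.inr 1} +
        q * (ENNReal.ofReal (96 * √((q + 3) * L)) * ENNReal.ofReal S₀ ^ q * rParam A) := by
  have hi := hν.integrable one_le_two
  rw [sigmaParam, ENNReal.coe_finset_sup]
  refine Finset.sup_le fun RC hRC => ?_
  obtain ⟨R, C⟩ := RC
  simp only [Finset.mem_filter, Finset.mem_univ, true_and] at hRC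
  obtain ⟨hRC, hR, hC⟩ := hRC
  have hd : Disjoint R C := by rw [hRC]; exact disjoint_compl_left
  have hu : R ∪ C = Finset.univ := by rw [hRC, Finset.union_comm, Finset.union_compl]
  have := (meanNorm_deviation A hν h1 hL hN hS₀ hxS hR hC hd hu Finset.univ).2
  rw [Finset.card_univ, Fintype.card_fin] at this
  simp only [flattening_eq_flat, ← enorm_eq_nnnorm]
  refine this.trans ?_
  gcongr
  obtain ⟨T, rfl⟩ := eq_image_inl_union hR
    (fun h => Finset.disjoint_left.mp hd h hC) (by decide)
  obtain ⟨T', rfl⟩ := eq_image_inl_union hC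
    (fun h => Finset.disjoint_left.mp hd hR h) (by decide)
  refine (meanNorm_image_union_le (tensor A) hi h0 T _ _).trans ?_
  rw [meanNorm_comm, meanNorm_comm ν _ _ {Sum.inr 0}]
  calc _ ≤ 4 ^ q * (4 ^ q * meanNorm ν (tensor A) Finset.univ {Sum.inr 1} {Sum.inr 0}) := by
        gcongr; exact meanNorm_image_union_le (tensor A) hi h0 T' _ _
    _ = _ := by rw [← mul_assoc, ← mul_pow]; norm_num

/-- The full multi-index with given chaos, row and column coordinates. -/
def fullIndex (i : Fin q → Fin m) (x : Fin d₁) (y : Fin d₂) : FullIndex q m d₁ d₂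
  | Sum.inl t => i t
  | Sum.inr 0 => x
  | Sum.inr 1 => y

/-- The row coordinate of a full multi-index. -/
def rowCoord (k : FullIndex q m d₁ d₂) : Fin d₁ := k (Sum.inr 0)

/-- The column coordinate of a full multi-index. -/
def colCoord (k : FullIndex q m d₁ d₂) : Fin d₂ := k (Sum.inr 1)

theorem decoupledChaos_eq_flat {Ω : Type*} (H : Fin q → Fin m → Ω → ℝ) (ω : Ω) :
    decoupledChaos A H ω =
      flat rowCoord colCoord (fun k : FullIndex q m d₁ d₂ => weight Finset.univ (fun t i => H t i ω) k * tensor A k) := by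
  ext x y
  simp only [decoupledChaos, flat, Matrix.sum_apply, Matrix.smul_apply, Matrix.of_apply,
    smul_eq_mul]
  rw [← Finset.sum_filter]
  refine Finset.sum_bij' (fun i _ => fullIndex i x y) (fun k _ t => k (Sum.inl t)) ?_ ?_ ?_ ?_ ?_
  · intro i _
    exact Finset.mem_filter.mpr ⟨Finset.mem_univ _, rfl, rfl⟩
  · intro k _
    exact Finset.mem_univ _
  · intro i _; rfl
  · intro k hk
    rw [Finset.mem_filter] at hk
    funext s
    match s with
    | Sum.inl t => rfl
    | Sum.inr 0 => exact hk.2.1.symm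
    | Sum.inr 1 => exact hk.2.2.symm
  · intro i _; rfl

theorem enorm_decoupledChaos {Ω : Type*} (H : Fin q → Fin m → Ω → ℝ) (ω : Ω) :
    ‖decoupledChaos A H ω‖ₑ = ‖flat (res {Sum.inr 0}) (res {Sum.inr 1})
      (fun k => weight Finset.univ (fun t i => H t i ω) k * tensor A k)‖ₑ := by
  rw [decoupledChaos_eq_flat, ← ofReal_norm, ← ofReal_norm]
  congr 1
  have key : ∀ (s : Coord q) (k k' : FullIndex q m d₁ d₂),
      k s = k' s ↔ res {s} k = res {s} k' := by
    intro s k k'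
    constructor
    · intro h
      funext ⟨u, hu⟩
      obtain rfl := Finset.mem_singleton.mp hu
      exact h
    · intro h
      exact congrFun h ⟨s, Finset.mem_singleton_self s⟩
  exact norm_flat_congr _ _ _ _ _ (key _) (key _)

theorem lintegral_enorm_decoupledChaos {Ω : Type*} [MeasurableSpace Ω] (P : Measure Ω)
    [IsProbabilityMeasure P] (H : Fin q → Fin m → Ω → ℝ) (hm : ∀ t i, AEMeasurable (H t i) P)
    (hlaw : ∀ t i, P.map (H t i) = ν) (hind : iIndepFun (fun p : Fin q × Fin m => H p.1 p.2) P) :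
    ∫⁻ ω, ‖decoupledChaos A H ω‖ₑ ∂P =
      meanNorm ν (tensor A) Finset.univ {Sum.inr 0} {Sum.inr 1} := by
  have h1 := (iIndepFun_iff_map_fun_eq_pi_map fun p : Fin q × Fin m => hm p.1 p.2).mp hind
  simp only [hlaw] at h1
  -- Independence gives a product law indexed by pairs; currying turns it into the iterated product
  -- `blockLaw`.
  have h2 := Measure.infinitePi_map_curry fun (_ : Fin q) (_ : Fin m) => ν
  simp only [Measure.infinitePi_eq_pi] at h2
  have hmm : AEMeasurable (fun ω (p : Fin q × Fin m) => H p.1 p.2 ω) P :=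
    aemeasurable_pi_lambda _ fun p => hm p.1 p.2
  have h3 : P.map (fun ω t i => H t i ω) = blockLaw ν q m := by
    rw [blockLaw, ← h2, ← h1, AEMeasurable.map_map_of_aemeasurable
      (MeasurableEquiv.measurable _).aemeasurable hmm]
    rfl
  rw [meanNorm, ← h3, lintegral_map' (measurable_enorm_flat_weight _ _ _ _).aemeasurable
    (aemeasurable_pi_lambda _ fun t => aemeasurable_pi_lambda _ fun i => hm t i)]
  exact lintegral_congr fun ω => enorm_decoupledChaos A H ω

end Assembly

/-! ### The maximum of independent copies and `α(h)` -/

section Constants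

theorem rpow_half_eq_sqrt_pow {x : ℝ} (hx : 0 ≤ x) (n : ℕ) : x ^ ((n : ℝ) / 2) = √x ^ n := by
  rw [Real.sqrt_eq_rpow, ← Real.rpow_natCast, ← Real.rpow_mul hx]
  congr 1; ring

variable {ν : Measure ℝ} [IsProbabilityMeasure ν] {m : ℕ}

theorem eLpNorm_two_eq_one (hν : MemLp (fun y => y) 2 ν) (h1 : ∫ y, y ^ 2 ∂ν = 1) :
    eLpNorm (fun y : ℝ => y) 2 ν = 1 := by
  rw [hν.eLpNorm_eq_integral_rpow_norm two_ne_zero ENNReal.ofNat_ne_top]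
  simp [h1]

theorem eLpNorm_pi_two_le (hν : MemLp (fun y => y) 2 ν) (h1 : ∫ y, y ^ 2 ∂ν = 1) :
    eLpNorm (fun x : Fin m → ℝ => x) 2 (Measure.pi fun _ => ν) ≤ ENNReal.ofReal √m := by
  refine (eLpNorm_pi_le (ν := ν) one_le_two ENNReal.ofNat_ne_top).trans ?_
  rw [eLpNorm_two_eq_one hν h1, mul_one, Fintype.card_fin, ← ENNReal.ofReal_natCast,
    ENNReal.ofReal_rpow_of_nonneg (by positivity) (by positivity), Real.sqrt_eq_rpow]
  simp

theorem eLpNorm_pi_two_le_of_exp {l : ℝ} (hl : 2 ≤ l)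
    (hm : (m : ℝ) ≤ Real.exp l) :
    eLpNorm (fun x : Fin m → ℝ => x) 2 (Measure.pi fun _ => ν) ≤
      3 * eLpNorm (fun y : ℝ => y) (ENNReal.ofReal l) ν := by
  have h2l : (2 : ℝ≥0∞) ≤ ENNReal.ofReal l := by
    rw [← ENNReal.ofReal_ofNat]; exact ENNReal.ofReal_le_ofReal hl
  refine (eLpNorm_le_eLpNorm_of_exponent_le h2l continuous_id.aestronglyMeasurable).trans ?_
  refine (eLpNorm_pi_le (ν := ν) (one_le_two.trans h2l) ENNReal.ofReal_ne_top).trans ?_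
  gcongr
  rw [ENNReal.toReal_ofReal (by linarith), Fintype.card_fin, ← ENNReal.ofReal_natCast,
    ENNReal.ofReal_rpow_of_nonneg (by positivity) (by positivity), ← ENNReal.ofReal_ofNat]
  refine ENNReal.ofReal_le_ofReal ?_
  calc (m : ℝ) ^ (1 / l) ≤ Real.exp l ^ (1 / l) := by gcongr
    _ = Real.exp 1 := by
        rw [← Real.exp_mul, mul_one_div_cancel (by linarith)]
    _ ≤ 3 := by linarith [Real.exp_one_lt_d9]

/-- A finite bound for the `L²` norm of the maximum, unless the right-hand side is infinite. -/
theorem exists_bound_or_top (hν : MemLp (fun y => y) 2 ν) (h1 : ∫ y, y ^ 2 ∂ν = 1) {l : ℝ}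
    (hl : 2 ≤ l) (hm : (m : ℝ) ≤ Real.exp l) (q : ℕ) (r : ℝ≥0) :
    (∃ S₀ : ℝ, 1 ≤ S₀ ∧
      eLpNorm (fun x : Fin m → ℝ => x) 2 (Measure.pi fun _ => ν) ≤ ENNReal.ofReal S₀ ∧
      ENNReal.ofReal S₀ ^ q * r ≤
        3 ^ q * (eLpNorm (fun y : ℝ => y) (ENNReal.ofReal l) ν ^ q * r)) ∨
    (eLpNorm (fun y : ℝ => y) (ENNReal.ofReal l) ν = ∞ ∧ r ≠ 0) := by
  set α := eLpNorm (fun y : ℝ => y) (ENNReal.ofReal l) ν with hα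
  have hα1 : 1 ≤ α := by
    rw [← eLpNorm_two_eq_one hν h1]
    refine eLpNorm_le_eLpNorm_of_exponent_le ?_ continuous_id.aestronglyMeasurable
    rw [← ENNReal.ofReal_ofNat]; exact ENNReal.ofReal_le_ofReal hl
  by_cases hr : r = 0
  · left
    -- With `r = 0` the size of `S₀` is irrelevant but it must be finite, while `α` may be infinite;
    -- unit variance supplies `√m`.
    refine ⟨√m + 1, by linarith [Real.sqrt_nonneg (m : ℝ)], ?_, by simp [hr]⟩
    exact (eLpNorm_pi_two_le hν h1).trans (ENNReal.ofReal_le_ofReal (by linarith))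
  by_cases htop : α = ∞
  · exact Or.inr ⟨htop, hr⟩
  · left
    have e : ENNReal.ofReal (3 * α.toReal) = 3 * α := by
      rw [ENNReal.ofReal_mul (by norm_num), ENNReal.ofReal_toReal htop, ENNReal.ofReal_ofNat]
    refine ⟨3 * α.toReal, ?_, ?_, ?_⟩
    · have : 1 ≤ α.toReal := by
        rw [← ENNReal.toReal_one]; exact ENNReal.toReal_mono htop hα1
      linarith
    · rw [e]; exact eLpNorm_pi_two_le_of_exp hl hm
    · rw [e, mul_pow, mul_assoc]

end Constants

theorem two_le_log_eight : (2 : ℝ) ≤ Real.log 8 := by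
  have : (8 : ℝ) = 2 ^ 3 := by norm_num
  rw [this, Real.log_pow]
  have := Real.log_two_gt_d9
  push_cast
  linarith

/-! ### Final bounds by dimension range -/

section Main

variable {q m d₁ d₂ : ℕ} (A : (Fin q → Fin m) → Matrix (Fin d₁) (Fin d₂) ℝ)
  {ν : Measure ℝ} [IsProbabilityMeasure ν]

theorem sigmaParam_le_of_log (hq : 1 ≤ q) (hν : MemLp (fun y => y) 2 ν) (h0 : ∫ y, y ∂ν = 0)
    (h1 : ∫ y, y ^ 2 ∂ν = 1) {l : ℝ} (hl : 2 ≤ l)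
    (hN : ((max d₁ d₂ + m : ℕ) : ℝ) ≤ Real.exp l) :
    (sigmaParam A : ℝ≥0∞) ≤
      16 ^ q * meanNorm ν (tensor A) Finset.univ {Sum.inr 0} {Sum.inr 1} +
      q * ENNReal.ofReal (96 * √(q + 3)) * 3 ^ q *
        (eLpNorm (fun y : ℝ => y) (ENNReal.ofReal l) ν ^ q * ENNReal.ofReal (√l ^ q) *
          rParam A) := by
  have hm : (m : ℝ) ≤ Real.exp l := by
    refine le_trans ?_ hN; norm_cast; exact Nat.le_add_left _ _
  have hl0 : 0 < √l := Real.sqrt_pos.mpr (by linarith)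
  have hq0 : (q : ℝ≥0∞) ≠ 0 := by exact_mod_cast (by omega : q ≠ 0)
  set α := eLpNorm (fun y : ℝ => y) (ENNReal.ofReal l) ν
  rcases exists_bound_or_top hν h1 hl hm q (rParam A) with ⟨S₀, hS, hxS, hSr⟩ | ⟨htop, hr⟩
  · refine (sigmaParam_le_meanNorm_add A hν h0 h1 hl hN hS hxS).trans ?_
    refine add_le_add le_rfl ?_
    rw [Real.sqrt_mul (by positivity), ← mul_assoc 96, ENNReal.ofReal_mul (by positivity)]
    -- The argument yields only one factor `√l`; the stated power is weaker since `q ≥ 1` and `l ≥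
    -- 1`.
    have hs : ENNReal.ofReal √l ≤ ENNReal.ofReal (√l ^ q) := by
      refine ENNReal.ofReal_le_ofReal ?_
      exact le_self_pow₀ (Real.one_le_sqrt.mpr (by linarith)) (by omega)
    calc _ = q * ENNReal.ofReal (96 * √(q + 3)) * ENNReal.ofReal √l *
          (ENNReal.ofReal S₀ ^ q * rParam A) := by ring
      _ ≤ q * ENNReal.ofReal (96 * √(q + 3)) * ENNReal.ofReal (√l ^ q) *
          (3 ^ q * (α ^ q * rParam A)) := by gcongr
      _ = _ := by ring
  -- If `α = ∞` and `r ≠ 0`, the right-hand side is infinite, provided no other factor vanishes.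
  · have hc : ENNReal.ofReal (96 * √(q + 3)) ≠ 0 := by
      rw [Ne, ENNReal.ofReal_eq_zero, not_le]; positivity
    have hl' : ENNReal.ofReal (√l ^ q) ≠ 0 := by
      rw [Ne, ENNReal.ofReal_eq_zero, not_le]; positivity
    rw [show α = ∞ from htop, ENNReal.top_pow (by omega), ENNReal.top_mul hl',
      ENNReal.top_mul (by exact_mod_cast hr), ENNReal.mul_top, add_top]
    · exact le_top
    · exact mul_ne_zero (mul_ne_zero hq0 hc) (by simp)

theorem meanNorm_le_of_log (hq : 1 ≤ q) (hν : MemLp (fun y => y) 2 ν) (h0 : ∫ y, y ∂ν = 0)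
    (h1 : ∫ y, y ^ 2 ∂ν = 1) {l : ℝ} (hl : 2 ≤ l)
    (hN : ((max d₁ d₂ + m : ℕ) : ℝ) ≤ Real.exp l) :
    meanNorm ν (tensor A) Finset.univ {Sum.inr 0} {Sum.inr 1} ≤
      ENNReal.ofReal (32 * √(q + 3)) ^ q *
        (1 + q * ENNReal.ofReal (96 * √(q + 3)) * 3 ^ q) *
      (ENNReal.ofReal (√l ^ q) * sigmaParam A +
        eLpNorm (fun y : ℝ => y) (ENNReal.ofReal l) ν ^ q * ENNReal.ofReal (√l ^ (q + 1)) *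
          rParam A) := by
  have hm : (m : ℝ) ≤ Real.exp l := by
    refine le_trans ?_ hN; norm_cast; exact Nat.le_add_left _ _
  have hl0 : 0 < √l := Real.sqrt_pos.mpr (by linarith)
  set α := eLpNorm (fun y : ℝ => y) (ENNReal.ofReal l) ν
  set c := ENNReal.ofReal (32 * √(q + 3)) ^ q with hc
  set D := q * ENNReal.ofReal (96 * √(q + 3)) * 3 ^ q with hD
  rcases exists_bound_or_top hν h1 hl hm q (rParam A) with ⟨S₀, hS, hxS, hSr⟩ | ⟨htop, hr⟩
  · refine (meanNorm_le_sigmaParam_add A hν h0 h1 hl hN hS hxS).trans ?_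
    rw [Real.sqrt_mul (by positivity), ← mul_assoc 96, ← mul_assoc 32,
      ENNReal.ofReal_mul (p := 32 * √(q + 3)) (by positivity),
      ENNReal.ofReal_mul (p := 96 * √(q + 3)) (by positivity),
      ENNReal.ofReal_pow hl0.le, ENNReal.ofReal_pow hl0.le]
    -- The power `q + 1` of `√l` collects `q` uses of Khintchine and one from the deviation.
    calc _ = c * (ENNReal.ofReal √l ^ q * sigmaParam A) +
          c * (q * ENNReal.ofReal (96 * √(q + 3)) * ENNReal.ofReal √l ^ (q + 1) *
          (ENNReal.ofReal S₀ ^ q * rParam A)) := by rw [hc]; ring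
      _ ≤ c * (ENNReal.ofReal √l ^ q * sigmaParam A) +
          c * (q * ENNReal.ofReal (96 * √(q + 3)) * ENNReal.ofReal √l ^ (q + 1) *
          (3 ^ q * (α ^ q * rParam A))) := by gcongr
      _ = c * 1 * (ENNReal.ofReal √l ^ q * sigmaParam A) +
          c * D * (α ^ q * ENNReal.ofReal √l ^ (q + 1) * rParam A) := by rw [hD]; ring
      _ ≤ c * (1 + D) * (ENNReal.ofReal √l ^ q * sigmaParam A) +
          c * (1 + D) * (α ^ q * ENNReal.ofReal √l ^ (q + 1) * rParam A) := by
          gcongr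
          · exact le_self_add
          · exact le_add_self
      _ = _ := by ring
  · have hc0 : c ≠ 0 := by
      refine pow_ne_zero _ ?_
      rw [Ne, ENNReal.ofReal_eq_zero, not_le]; positivity
    have hl' : ENNReal.ofReal (√l ^ (q + 1)) ≠ 0 := by
      rw [Ne, ENNReal.ofReal_eq_zero, not_le]; positivity
    rw [show α = ∞ from htop, ENNReal.top_pow (by omega), ENNReal.top_mul hl',
      ENNReal.top_mul (by exact_mod_cast hr), add_top, ENNReal.mul_top]
    · exact le_top
    · simp [hc0]

/-- The upper bound for small dimensions. -/
theorem meanNorm_le_of_lt_eight (hν : MemLp (fun y => y) 2 ν) (h0 : ∫ y, y ∂ν = 0)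
    (h1 : ∫ y, y ^ 2 ∂ν = 1) (hN2 : 2 ≤ max d₁ d₂ + m) (hN8 : max d₁ d₂ + m < 8) :
    meanNorm ν (tensor A) Finset.univ {Sum.inr 0} {Sum.inr 1} ≤
      9 ^ q * ENNReal.ofReal (32 * √(q + 3)) ^ q *
        (ENNReal.ofReal (√(logDim m d₁ d₂) ^ q) * sigmaParam A) := by
  -- Dimensions up to `7` fit under `exp 2`, so the iteration runs with `L = 2`, the least value it
  -- admits.
  have hN : ((max d₁ d₂ + m : ℕ) : ℝ) ≤ Real.exp 2 := by
    have h7 : ((max d₁ d₂ + m : ℕ) : ℝ) ≤ 7 := by exact_mod_cast (by omega)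
    have e : Real.exp 2 = Real.exp 1 * Real.exp 1 := by rw [← Real.exp_add]; norm_num
    have := Real.exp_one_gt_d9
    nlinarith
  have hxS : eLpNorm (fun x : Fin m → ℝ => x) 2 (Measure.pi fun _ => ν) ≤ ENNReal.ofReal 3 := by
    refine (eLpNorm_pi_two_le hν h1).trans (ENNReal.ofReal_le_ofReal ?_)
    refine Real.sqrt_le_iff.mpr ⟨by norm_num, ?_⟩
    have : (m : ℝ) ≤ 7 := by exact_mod_cast (by omega)
    linarith
  refine (meanNorm_le_sigmaParam A (hν.integrable one_le_two) h0 le_rfl hN hxS).trans ?_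
  have hlog : Real.log 2 ≤ logDim m d₁ d₂ := by
    unfold logDim
    gcongr
    exact_mod_cast hN2
  have hlog2 := Real.log_two_gt_d9
  have key : 32 * √((q + 3) * 2) * 3 ≤ 9 * (32 * √(q + 3)) * √(logDim m d₁ d₂) := by
    -- Because `log 2` is bounded below, the missing factor `√logDim` costs only a constant; with
    -- `S₀ = 3` this gives `9`.
    have : √2 ≤ 3 * √(logDim m d₁ d₂) := by
      refine Real.sqrt_le_iff.mpr ⟨by positivity, ?_⟩
      rw [mul_pow, Real.sq_sqrt (by linarith)]
      linarith
    rw [Real.sqrt_mul (by positivity)]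
    nlinarith [Real.sqrt_nonneg ((q : ℝ) + 3)]
  have key2 := pow_le_pow_left' (ENNReal.ofReal_le_ofReal key) q
  rw [ENNReal.ofReal_mul (p := 32 * √((q + 3) * 2)) (by positivity),
    ENNReal.ofReal_mul (p := 9 * (32 * √(q + 3))) (by positivity),
    ENNReal.ofReal_mul (p := 9) (by norm_num), mul_pow, mul_pow, mul_pow, ENNReal.ofReal_ofNat 9,
    ← ENNReal.ofReal_pow (Real.sqrt_nonneg _)] at key2
  rw [← mul_assoc, ← mul_assoc]
  gcongr

end Main

/-- A matrix with an entry has `d₁ ≥ 1`, which forces `m = 0`; as `q ≥ 1`, the sum is then empty. -/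
theorem decoupledChaos_eq_zero {q m d₁ d₂ : ℕ} (hq : 1 ≤ q)
    (A : (Fin q → Fin m) → Matrix (Fin d₁) (Fin d₂) ℝ) {Ω : Type*} (H : Fin q → Fin m → Ω → ℝ)
    (ω : Ω) (hN : max d₁ d₂ + m < 2) : decoupledChaos A H ω = 0 := by
  ext x y
  have hx := x.2
  have hd := le_max_left d₁ d₂
  obtain rfl : m = 0 := by omega
  have : IsEmpty (Fin q → Fin 0) := ⟨fun i => (i ⟨0, hq⟩).elim0⟩
  simp [decoupledChaos]

end MatrixChaos
/-- The expectation `E‖Y‖` is the `[0, ∞]`-valued integral of the spectral norm of `Y`. The lower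
bound `σ - C α^q log^{q/2} r ≤ K₁ E‖Y‖` is written as `σ ≤ K₁ E‖Y‖ + C α^q log^{q/2} r`, to avoid
subtraction in `[0, ∞]`. The constants depend on `q` only. -/
theorem mainTheorem3 (q : ℕ) (hq : 1 ≤ q) :
    ∃ C K₁ K₂ : ℝ≥0, ∀ (m d₁ d₂ : ℕ) (A : (Fin q → Fin m) → Matrix (Fin d₁) (Fin d₂) ℝ)
      {Ω₀ : Type*} [MeasurableSpace Ω₀] (μ : Measure Ω₀) [IsProbabilityMeasure μ] (h : Ω₀ → ℝ)
      {Ω : Type*} [MeasurableSpace Ω] (P : Measure Ω) [IsProbabilityMeasure P]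
      (H : Fin q → Fin m → Ω → ℝ),
      MemLp h 2 μ → ∫ x, h x ∂μ = 0 → variance h μ = 1 →
      (∀ t i, IdentDistrib (H t i) h P μ) →
      iIndepFun (fun p : Fin q × Fin m => H p.1 p.2) P →
      (8 ≤ max d₁ d₂ + m →
        (MatrixChaos.sigmaParam A : ℝ≥0∞) ≤
          K₁ * ∫⁻ ω, ‖MatrixChaos.decoupledChaos A H ω‖ₑ ∂P +
          C * (MatrixChaos.alphaParam μ h m d₁ d₂ ^ q *
            ENNReal.ofReal (MatrixChaos.logDim m d₁ d₂ ^ ((q : ℝ) / 2)) *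
            MatrixChaos.rParam A)) ∧
      ∫⁻ ω, ‖MatrixChaos.decoupledChaos A H ω‖ₑ ∂P ≤
        K₂ * (ENNReal.ofReal (MatrixChaos.logDim m d₁ d₂ ^ ((q : ℝ) / 2)) *
            MatrixChaos.sigmaParam A +
          MatrixChaos.alphaParam μ h m d₁ d₂ ^ q *
            ENNReal.ofReal (MatrixChaos.logDim m d₁ d₂ ^ (((q : ℝ) + 1) / 2)) *
            MatrixChaos.rParam A) := by
  -- The third constant dominates both upper bounds: `9 ^ q` is needed for dimensions below `8`, the
  -- last factor for the others.
  refine ⟨q * Real.toNNReal (96 * √(q + 3)) * 3 ^ q, 16 ^ q,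
    9 ^ q * Real.toNNReal (32 * √(q + 3)) ^ q *
      (1 + q * Real.toNNReal (96 * √(q + 3)) * 3 ^ q), ?_⟩
  intro m d₁ d₂ A Ω₀ _ μ _ h Ω _ P _ H hL2 hmean hvar hid hind
  have hae : AEMeasurable h μ := hL2.aestronglyMeasurable.aemeasurable
  set ν := μ.map h with hν
  have : IsProbabilityMeasure ν := Measure.isProbabilityMeasure_map hae
  have hid2 : AEStronglyMeasurable (fun y : ℝ => y) ν := continuous_id.aestronglyMeasurable
  have hν2 : MemLp (fun y : ℝ => y) 2 ν := (memLp_map_measure_iff hid2 hae).mpr hL2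
  have hν0 : ∫ y, y ∂ν = 0 := by rw [hν, integral_map hae hid2, hmean]
  have hν1 : ∫ y, y ^ 2 ∂ν = 1 := by
    rw [hν, integral_map hae (by fun_prop), ← hvar, variance_of_integral_eq_zero hae hmean]
  have hα : ∀ p, eLpNorm h p μ = eLpNorm (fun y : ℝ => y) p ν := fun p =>
    (eLpNorm_map_measure hid2 hae).symm
  rw [MatrixChaos.lintegral_enorm_decoupledChaos A P H (fun t i => (hid t i).aemeasurable_fst)
    (fun t i => (hid t i).map_eq) hind, MatrixChaos.alphaParam, hα]
  set l := MatrixChaos.logDim m d₁ d₂ with hl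
  have hl0 : 0 ≤ l := Real.log_natCast_nonneg _
  have hq1 : l ^ (((q : ℝ) + 1) / 2) = √l ^ (q + 1) := by
    rw [← MatrixChaos.rpow_half_eq_sqrt_pow hl0]; push_cast; rfl
  rw [hq1, MatrixChaos.rpow_half_eq_sqrt_pow hl0]
  push_cast
  have large : 8 ≤ max d₁ d₂ + m → 2 ≤ l ∧ ((max d₁ d₂ + m : ℕ) : ℝ) ≤ Real.exp l := by
    intro h8
    refine ⟨MatrixChaos.two_le_log_eight.trans ?_, (Real.exp_log ?_).ge⟩
    · rw [hl, MatrixChaos.logDim]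
      gcongr
      exact_mod_cast h8
    · exact_mod_cast (by omega)
  refine ⟨fun h8 => ?_, ?_⟩
  · obtain ⟨hl2, hN⟩ := large h8
    exact MatrixChaos.sigmaParam_le_of_log A hq hν2 hν0 hν1 hl2 hN
  rcases lt_or_ge (max d₁ d₂ + m) 8 with h8 | h8
  · rcases lt_or_ge (max d₁ d₂ + m) 2 with h2 | h2
    · rw [← MatrixChaos.lintegral_enorm_decoupledChaos A P H
        (fun t i => (hid t i).aemeasurable_fst) (fun t i => (hid t i).map_eq) hind]
      simp [MatrixChaos.decoupledChaos_eq_zero hq A H _ h2]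
    · refine (MatrixChaos.meanNorm_le_of_lt_eight A hν2 hν0 hν1 h2 h8).trans ?_
      -- In this range `σ` alone suffices, and the term with `r` is simply added. Here `log (d + m)
      -- < 2`, so `α` need not control the second moment.
      refine mul_le_mul' ?_ le_self_add
      exact le_mul_of_one_le_right' le_self_add
  · obtain ⟨hl2, hN⟩ := large h8
    refine (MatrixChaos.meanNorm_le_of_log A hq hν2 hν0 hν1 hl2 hN).trans ?_
    refine mul_le_mul' (mul_le_mul' ?_ le_rfl) le_rfl
    exact le_mul_of_one_le_left' (one_le_pow₀ (by norm_num))
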